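/- Let $\pi$ be a strictly positive joint distribution of finitely many variables $X_j$ ($j\in M$) with values in $\{0,\dots,r_j\}$. A parameter index is a pair $t=(K,x_K)$ with $\emptyset\ne K\subseteq M$ and $x_j>0$ for $j\in K$. Its log-linear parameter is $\eta_t(\pi)=\sum_{J\subseteq K}(-1)^{|K\setminus J|}\log\pi(x_J,0)$, and its mean parameter is $\mu_t(\pi)=P_\pi(X_K=x_K)$. Let $F(\pi)$ be the covariance matrix under $\pi$ of the indicators of the events $X_K=x_K$. Let $V$ be a set of indices, $L$ its complement, $\emptyset\ne I\subseteq V$, $R=V\setminus I$, and $H\subseteq L$ with $|H|=|I|$. Put $\xi(\pi)=(\eta_{(L\cup I)\setminus H}(\pi),\mu_V(\pi))$, and call $\xi$ compatible if $\xi=\xi(\pi)$ for some strictly positive $\pi$. Put $Q=F_{IH}-F_{IR}F_{RR}^{-1}F_{RH}$, $A=F_{HH}-F_{HR}F_{RR}^{-1}F_{RH}$, $B=F_{HH}-F_{HV}F_{VV}^{-1}F_{VH}$, $J=A^{-1}B$. One step of the LM algorithm for $\xi$ maps a guess $h$ of $\eta_H$ to $\eta_H(q)$. Here (M-step) $p$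 is the distribution with the $\mu_V$ and $\eta_{L\setminus H}$ of $\xi$ and with $\eta_H(p)=h$, and (L-step) $q$ is the distribution with the $\mu_R$ and $\eta_{I\cup(L\setminus H)}$ of $\xi$ and with $\mu_H(q)=\mu_H(p)$. We say that the algorithm converges at $\pi$ if, when it is run with $\xi=\xi(\pi)$ from any starting value close enough to $\eta_H(\pi)$, the guesses converge to $\eta_H(\pi)$ at a (uniform) geometric rate and the distributions $q$ converge to $\pi$. For compatible $\xi$ both steps are well defined for every guess, and $J(\pi)$ is the Jacobian at $\eta_H(\pi)$ of the LM step for $\xi(\pi)$. Moreover: (1) If $Q(\pi)$ has full rank, the algorithm converges at $\pi$, and near $\pi$ the correspondence between $\xi$ and $\pi$ is one to one, with $\xi$ ranging over an open set and $\pi$ a smooth function of $\xi$. If $Q(\pi)$ has full rank for every strictly positive $\pi$, then the correspondence between all compatible $\xi$ and all strictly positive $\pi$ is one to one, the set of compatible $\xi$ is open, and $\pi$ is a smooth function of $\xi$; moreover every bounded sequence of guesses produced by the algorithm for $\xi(\pi)$, from any starting value, converges to $\eta_H(\pi)$, and then the distributions $q$ converge to $\pi$. (2) If $Q(\pi)=0$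 for some strictly positive $\pi$, then $J(\pi)$ is the identity and $\xi$ is not one to one on the strictly positive distributions. If, for a compatible $\xi$, $Q=0$ at every strictly positive distribution with the $\mu_R$ and $\eta_{(L\cup I)\setminus H}$ of $\xi$, then the algorithm stays at its starting value, whatever this is, and for every $h$ there is a strictly positive $\pi$ with $\xi(\pi)=\xi$ and $\eta_H(\pi)=h$. (3) If $Q(\pi)$ is singular but nonzero, then the algorithm does not converge at $\pi$, and there is a compatible $\xi$ for which it does not converge to one and the same distribution from all starting values. (Nothing is asserted about the smoothness of the map in this case.) -/

import Mathlib

open Filter Topology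
open scoped ContDiff Matrix

namespace LMRec

/-- Cells of the table of the variables in the margin `M` (indexed by `ι`);
variable `j` takes the values `0, …, r j`. -/
abbrev Cell {ι : Type} (r : ι → ℕ) : Type := (j : ι) → Fin (r j + 1)

/-- A single log-linear or mean parameter is a pair `(I, x_I)` of a non-empty interaction
`I ⊆ M` and values `x_j > 0`, `j ∈ I`.  It is coded by the cell equal to `x_j` for `j ∈ I` and
to `0` outside `I`; these are exactly the cells different from the all-zero cell. -/
abbrev Param {ι : Type} (r : ι → ℕ) : Type := {t : Cell r // t ≠ 0}

variable {ι : Type} [Fintype ι] [DecidableEq ι] {r : ι → ℕ}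

/-- The interaction `I` of the parameter `(I, x_I)`. -/
def interaction (t : Param r) : Finset ι := Finset.univ.filter fun j => t.1 j ≠ 0

/-- The cell `(x_J, 0, …, 0)`. -/
def restrict (t : Param r) (J : Finset ι) : Cell r := fun j => if j ∈ J then t.1 j else 0

/-- Strictly positive probability distributions on the table. -/
def Distr (r : ι → ℕ) : Set (Cell r → ℝ) := {π | (∀ x, 0 < π x) ∧ ∑ x, π x = 1}

/-- Reference category log-linear interaction
`η_{I;M}(x_I) = ∑_{J ⊆ I} (-1)^{|I \ J|} log π(x_J, 0)`. -/
noncomputable def eta (π : Cell r → ℝ) (t : Param r) : ℝ :=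
  ∑ J ∈ (interaction t).powerset,
    (-1 : ℝ) ^ (interaction t \ J).card * Real.log (π (restrict t J))

/-- The matrix `G(M)`: the column of `(I, x_I)` is the indicator of the event `X_I = x_I`. -/
def G (r : ι → ℕ) : Matrix (Cell r) (Param r) ℝ :=
  fun x t => if ∀ j ∈ interaction t, x j = t.1 j then 1 else 0

/-- Mean parameters `μ = G' π`, i.e. the marginal probabilities `P(X_I = x_I)`. -/
def mu (π : Cell r → ℝ) (t : Param r) : ℝ := ((G r)ᵀ *ᵥ π) t

/-- `Ω = diag(π) - π π'`. -/
def Omega (π : Cell r → ℝ) : Matrix (Cell r) (Cell r) ℝ :=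
  Matrix.diagonal π - Matrix.vecMulVec π π

/-- `F = G' Ω G`. -/
def F (π : Cell r → ℝ) : Matrix (Param r) (Param r) ℝ := (G r)ᵀ * Omega π * G r

/-- The block `F_{ST}`. -/
def Fblock (π : Cell r → ℝ) (S T : Finset (Param r)) : Matrix S T ℝ :=
  (F π).submatrix Subtype.val Subtype.val

/-- `F_{ST} - F_{SK} F_{KK}⁻¹ F_{KT}`. -/
noncomputable def Fcond (π : Cell r → ℝ) (S T K : Finset (Param r)) : Matrix S T ℝ :=
  Fblock π S T - Fblock π S K * (Fblock π K K)⁻¹ * Fblock π K T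

/-- `Q_{IH|R}`, with `R = V \ I`. -/
noncomputable def Q (V I H : Finset (Param r)) (π : Cell r → ℝ) : Matrix I H ℝ :=
  Fcond π I H (V \ I)

/-- `J = A⁻¹ B` with `A = F_{HH} - F_{HR} F_{RR}⁻¹ F_{RH}` and
`B = F_{HH} - F_{HV} F_{VV}⁻¹ F_{VH}`. -/
noncomputable def Jac (V I H : Finset (Param r)) (π : Cell r → ℝ) : Matrix H H ℝ :=
  (Fcond π H H (V \ I))⁻¹ * Fcond π H H V

/-- `(L ∪ I) \ H`, where `L` is the complement of `V`. -/
def freeEta (V I H : Finset (Param r)) : Finset (Param r) := (Vᶜ ∪ I) \ H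

/-- The space of the pairs `ξ = (η_{L ∪ I \ H}, μ_V)`. -/
abbrev Xi (V I H : Finset (Param r)) : Type := (freeEta V I H → ℝ) × (V → ℝ)

/-- The parameters `ξ` of the distribution `π`. -/
noncomputable def xi (V I H : Finset (Param r)) (π : Cell r → ℝ) : Xi V I H :=
  (fun t => eta π t.1, fun t => mu π t.1)

/-- The log-linear parameters in `H`. -/
noncomputable def etaOn (H : Finset (Param r)) (π : Cell r → ℝ) : H → ℝ := fun t => eta π t.1

/-- The mean parameters in `H`. -/
def muOn (H : Finset (Param r)) (π : Cell r → ℝ) : H → ℝ := fun t => mu π t.1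

/-- M-step: `p` is the distribution whose mean parameters in `V` and log-linear parameters in
`L \ H` are those in `ξ` and whose log-linear parameters in `H` are the current guess `h`. -/
def IsMStep (V I H : Finset (Param r)) (ξ : Xi V I H) (h : H → ℝ) (p : Cell r → ℝ) : Prop :=
  p ∈ Distr r ∧ (∀ t : V, mu p t.1 = ξ.2 t) ∧
    (∀ t : freeEta V I H, t.1 ∉ V → eta p t.1 = ξ.1 t) ∧ etaOn H p = h

/-- L-step: `q` is the distribution whose mean parameters in `R = V \ I` and log-linear parameters
in `I ∪ (L \ H)` are those in `ξ` and whose mean parameters in `H` are the current guess `m`. -/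
def IsLStep (V I H : Finset (Param r)) (ξ : Xi V I H) (m : H → ℝ) (q : Cell r → ℝ) : Prop :=
  q ∈ Distr r ∧ (∀ t : V, t.1 ∉ I → mu q t.1 = ξ.2 t) ∧ muOn H q = m ∧
    (∀ t : freeEta V I H, eta q t.1 = ξ.1 t)

/-- The distribution produced by the M-step. -/
noncomputable def mDist (V I H : Finset (Param r)) (ξ : Xi V I H) (h : H → ℝ) : Cell r → ℝ :=
  Classical.epsilon (IsMStep V I H ξ h)

/-- The distribution produced by an M-step followed by an L-step. -/
noncomputable def lDist (V I H : Finset (Param r)) (ξ : Xi V I H) (h : H → ℝ) : Cell r → ℝ :=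
  Classical.epsilon (IsLStep V I H ξ (muOn H (mDist V I H ξ h)))

/-- One full step of the LM algorithm, as a map of the guess for `η_H`. -/
noncomputable def lmStep (V I H : Finset (Param r)) (ξ : Xi V I H) (h : H → ℝ) : H → ℝ :=
  etaOn H (lDist V I H ξ h)

/-- On the set `T` of distributions, `ξ` determines `π` and the map `ξ ↦ π`, which is defined on an
open set of parameters, is smooth. -/
def SmoothOneToOneOn (V I H : Finset (Param r)) (T : Set (Cell r → ℝ)) : Prop :=
  Set.InjOn (xi V I H) T ∧ IsOpen (xi V I H '' T) ∧
    ∃ Φ : Xi V I H → (Cell r → ℝ),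
      ContDiffOn ℝ ∞ Φ (xi V I H '' T) ∧ ∀ π ∈ T, Φ (xi V I H π) = π

/-- The LM algorithm run with the parameters of `π` converges to `π`, at a geometric rate, from all
starting values close enough to `η_H(π)`. -/
def LMConvergesAt (V I H : Finset (Param r)) (π : Cell r → ℝ) : Prop :=
  ∃ ρ : ℝ, 0 ≤ ρ ∧ ρ < 1 ∧ ∃ C : ℝ, ∀ᶠ h in 𝓝 (etaOn H π),
    (∀ n : ℕ, ‖(lmStep V I H (xi V I H π))^[n] h - etaOn H π‖ ≤ C * ρ ^ n * ‖h - etaOn H π‖) ∧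
    Tendsto (fun n : ℕ => lDist V I H (xi V I H π) ((lmStep V I H (xi V I H π))^[n] h))
      atTop (𝓝 π)

end LMRec

/-! The strictly positive distributions form a full exponential family with design matrix `G`. Hence
`eta` is a global coordinate system, and `F` is the Jacobian of `mu` in it and is positive definite.
A tangent vector that moves neither the free `eta` nor `μ_R` is determined by its part `v` on `H`,
and it moves `μ_I` by `Q v`. So the differential of `xi` is invertible exactly when `Q` is
(`nondegenerate_iff`), and the inverse function theorem gives the local statements. The passage to
global statements uses a secant version of `dμ = F dη`. The differences of `mu` and `eta` between
two distributions are related by a positive multiple of `F p`, with `p` the normalised cellwise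
logarithmic mean (`exists_mu_sub_mu`), and every `p` and every direction occur in this way
(`exists_eta_sub_eta`). Thus `xi` is injective if and only if `Q` is nonsingular everywhere
(`injOn_xi_iff`). Both steps of the algorithm exist because a cross entropy attains its minimum
(`exists_mixed`). For `J = A⁻¹B`, the form `A - B` is positive semidefinite and vanishes exactly on
the kernel of `Q`. So `J` shrinks the `A`-norm strictly off this kernel (`Jac_contracts`) and fixes
the kernel pointwise, which decides local convergence. For bounded orbits, the divergence between
the distributions of the two steps is a Lyapunov function by two Pythagorean identities, and fixed
points are unique (`eq_of_isFixedPt_lmStep`). If `Q` vanishes along a fibre, `μ_I` is constant there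
and every guess is fixed. If `Q` is singular somewhere, two distributions share the same `ξ` and
both are fixed. -/

namespace LMRec
set_option linter.unusedSectionVars false
variable {ι : Type} [Fintype ι] [DecidableEq ι] {r : ι → ℕ}

/-! ### Log-linear parameters as global coordinates -/

/-- The alternating sum over the subsets of the interaction of `t`, as a linear functional of a
function on the table. -/
def contrast (r : ι → ℕ) : (Cell r → ℝ) →ₗ[ℝ] (Param r → ℝ) where
  toFun f t := ∑ J ∈ (interaction t).powerset,
    (-1 : ℝ) ^ (interaction t \ J).card * f (restrict t J)
  map_add' f g := by
    ext t
    simp [mul_add, Finset.sum_add_distrib]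
  map_smul' c f := by
    ext t
    simp [Finset.mul_sum, mul_left_comm]

theorem eta_eq_contrast (π : Cell r → ℝ) : eta π = contrast r fun x => Real.log (π x) := rfl

theorem interaction_nonempty (t : Param r) : (interaction t).Nonempty := by
  obtain ⟨t, ht⟩ := t
  obtain ⟨j, hj⟩ := Function.ne_iff.1 ht
  exact ⟨j, by simpa [interaction] using hj⟩

theorem mem_interaction {t : Param r} {j : ι} : j ∈ interaction t ↔ t.1 j ≠ 0 := by
  simp [interaction]

/-- Expanding the product turns alternating sums over subsets into products, which vanish as soon as
one factor does. -/
theorem sum_powerset_neg_one_pow_sdiff_mul {K : Finset ι} (f : ι → ℝ) :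
    ∑ J ∈ K.powerset, (-1 : ℝ) ^ (K \ J).card * ∏ j ∈ K \ J, f j = ∏ j ∈ K, (1 - f j) := by
  have h := Finset.prod_add (fun _ => (1 : ℝ)) (fun j => -f j) K
  simp only [← sub_eq_add_neg] at h
  rw [h]
  refine Finset.sum_congr rfl fun J _ => ?_
  rw [Finset.prod_const_one, one_mul, Finset.prod_neg]

theorem contrast_const (c : ℝ) : contrast r (fun _ => c) = 0 := by
  ext t
  have h := sum_powerset_neg_one_pow_sdiff_mul (K := interaction t) (fun _ => (1 : ℝ))
  obtain ⟨j, hj⟩ := interaction_nonempty t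
  rw [Finset.prod_eq_zero hj (by simp)] at h
  simp only [Finset.prod_const_one, mul_one] at h
  simp only [contrast, LinearMap.coe_mk, AddHom.coe_mk, Pi.zero_apply]
  rw [← Finset.sum_mul, h, zero_mul]

theorem contrast_G_col (s t : Param r) :
    contrast r (fun x => G r x s) t = if t = s then 1 else 0 := by
  -- The indicator factorises over the coordinates set to zero: the event survives the restriction
  -- only if none of them lies in the interaction of `s`.
  have key : ∀ J ∈ (interaction t).powerset, G r (restrict t J) s =
      if (∀ j ∈ interaction s, t.1 j = s.1 j) then
        ∏ j ∈ interaction t \ J, (if j ∉ interaction s then (1 : ℝ) else 0) else 0 := by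
    intro J hJ
    have hJ := Finset.mem_powerset.1 hJ
    rw [Finset.prod_ite_zero]
    simp only [G, restrict, Finset.prod_const_one]
    rw [← ite_and]
    refine if_congr ⟨fun h => ⟨fun j hj => ?_, fun j hj hjs => ?_⟩, fun h j hj => ?_⟩ rfl rfl
    · have := h j hj
      split_ifs at this with hjJ
      · exact this
      · exact absurd this.symm (mem_interaction.1 hj)
    · have := h j hjs
      rw [if_neg (Finset.mem_sdiff.1 hj).2] at this
      exact mem_interaction.1 hjs this.symm
    · have hjt : j ∈ interaction t := by
        rw [mem_interaction, h.1 j hj]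
        exact mem_interaction.1 hj
      have : j ∈ J := by
        by_contra hjJ
        exact h.2 j (Finset.mem_sdiff.2 ⟨hjt, hjJ⟩) hj
      rw [if_pos this]
      exact h.1 j hj
  simp only [contrast, LinearMap.coe_mk, AddHom.coe_mk]
  rw [Finset.sum_congr rfl fun J hJ => by rw [key J hJ]]
  by_cases h : ∀ j ∈ interaction s, t.1 j = s.1 j
  · simp only [if_pos h]
    rw [sum_powerset_neg_one_pow_sdiff_mul]
    by_cases hts : t = s
    · subst hts
      rw [if_pos rfl]
      exact Finset.prod_eq_one fun j hj => by simp [hj]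
    · rw [if_neg hts]
      have : ∃ j ∈ interaction t, j ∉ interaction s := by
        by_contra! hc
        apply hts
        apply Subtype.ext
        funext j
        by_cases hj : j ∈ interaction s
        · exact h j hj
        · have h1 : j ∉ interaction t := fun hh => hj (hc j hh)
          rw [mem_interaction, not_not] at hj h1
          rw [hj, h1]
      obtain ⟨j, hj, hjs⟩ := this
      exact Finset.prod_eq_zero hj (by simp [hjs])
  · simp only [if_neg h, mul_zero, Finset.sum_const_zero]
    rw [if_neg]
    rintro rfl
    exact h fun _ _ => rfl

theorem contrast_G_mulVec (θ : Param r → ℝ) : contrast r (G r *ᵥ θ) = θ := by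
  have : G r *ᵥ θ = ∑ s, θ s • fun x => G r x s := by
    ext x
    simp [Matrix.mulVec, dotProduct, Finset.sum_apply, mul_comm]
  rw [this, map_sum]
  ext t
  simp [Finset.sum_apply, contrast_G_col]

/-- `contrast` kills constants and is a left inverse of `G`, so `(c, θ) ↦ c + G θ` is injective.
There is one parameter fewer than cells, so it is bijective by dimension. -/
theorem eq_const_add_G_mulVec (f : Cell r → ℝ) :
    ∃ c : ℝ, f = (fun _ => c) + G r *ᵥ contrast r f := by
  let L : (ℝ × (Param r → ℝ)) →ₗ[ℝ] (Cell r → ℝ) :=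
    (LinearMap.pi fun _ => LinearMap.id).coprod (G r).mulVecLin
  have hL : ∀ c θ, L (c, θ) = (fun _ => c) + G r *ᵥ θ := fun c θ => rfl
  have hinj : Function.Injective L := by
    rw [← LinearMap.ker_eq_bot, LinearMap.ker_eq_bot']
    rintro ⟨c, θ⟩ h
    rw [hL] at h
    have h1 := congrArg (contrast r) h
    rw [map_add, contrast_const, contrast_G_mulVec, map_zero, zero_add] at h1
    subst h1
    have h2 := congrFun h 0
    simp at h2
    simp [h2]
  have hsurj : Function.Surjective L := by
    rw [← LinearMap.injective_iff_surjective_of_finrank_eq_finrank]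
    · exact hinj
    · rw [Module.finrank_prod, Module.finrank_self, Module.finrank_fintype_fun_eq_card,
        Module.finrank_fintype_fun_eq_card, Fintype.card_subtype_compl, Fintype.card_subtype_eq]
      have : 0 < Fintype.card (Cell r) := Fintype.card_pos
      omega
  obtain ⟨⟨c, θ⟩, h⟩ := hsurj f
  refine ⟨c, ?_⟩
  rw [← h, hL, map_add, contrast_const, contrast_G_mulVec, zero_add]

/-- The strictly positive distribution with log-linear parameters `θ`. -/
noncomputable def expFam (θ : Param r → ℝ) : Cell r → ℝ := fun x =>
  Real.exp ((G r *ᵥ θ) x) / ∑ y, Real.exp ((G r *ᵥ θ) y)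

theorem sum_exp_pos (f : Cell r → ℝ) : 0 < ∑ y, Real.exp (f y) :=
  Finset.sum_pos (fun _ _ => Real.exp_pos _) Finset.univ_nonempty

theorem expFam_mem (θ : Param r → ℝ) : expFam θ ∈ Distr r := by
  refine ⟨fun x => div_pos (Real.exp_pos _) (sum_exp_pos _), ?_⟩
  simp only [expFam]
  rw [← Finset.sum_div, div_self (sum_exp_pos _).ne']

theorem log_expFam (θ : Param r → ℝ) (x : Cell r) :
    Real.log (expFam θ x) = (G r *ᵥ θ) x - Real.log (∑ y, Real.exp ((G r *ᵥ θ) y)) := by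
  rw [expFam, Real.log_div (Real.exp_ne_zero _) (sum_exp_pos _).ne', Real.log_exp]

@[simp] theorem eta_expFam (θ : Param r → ℝ) : eta (expFam θ) = θ := by
  have : (fun x => Real.log (expFam θ x)) =
      G r *ᵥ θ - fun _ => Real.log (∑ y, Real.exp ((G r *ᵥ θ) y)) := by
    ext x
    rw [log_expFam, Pi.sub_apply]
  rw [eta_eq_contrast, this, map_sub, contrast_const, contrast_G_mulVec, sub_zero]

theorem exists_log_eq {π : Cell r → ℝ} : ∃ c : ℝ, ∀ x, Real.log (π x) = c + (G r *ᵥ eta π) x := by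
  obtain ⟨c, hc⟩ := eq_const_add_G_mulVec fun x => Real.log (π x)
  exact ⟨c, fun x => congrFun hc x⟩

theorem expFam_eta {π : Cell r → ℝ} (hπ : π ∈ Distr r) : expFam (eta π) = π := by
  obtain ⟨c, hc⟩ := exists_log_eq (π := π)
  have h : ∀ x, Real.exp ((G r *ᵥ eta π) x) = Real.exp (-c) * π x := by
    intro x
    rw [← Real.exp_log (hπ.1 x), ← Real.exp_add, hc, neg_add_cancel_left]
  ext x
  simp only [expFam, h]
  rw [← Finset.mul_sum, hπ.2, mul_one, mul_div_cancel_left₀ _ (Real.exp_ne_zero _)]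

theorem eta_injOn : Set.InjOn (eta (r := r)) (Distr r) := fun π hπ π' hπ' h => by
  rw [← expFam_eta hπ, h, expFam_eta hπ']

/-! ### The covariance matrix is positive definite -/

theorem mu_eq (π : Cell r → ℝ) : mu π = (G r)ᵀ *ᵥ π := rfl

theorem Omega_mulVec (π f : Cell r → ℝ) (x : Cell r) :
    (Omega π *ᵥ f) x = π x * (f x - ∑ y, π y * f y) := by
  rw [Omega, Matrix.sub_mulVec, Matrix.vecMulVec_mulVec]
  simp [Matrix.mulVec_diagonal, dotProduct, mul_sub]

theorem F_mulVec (π : Cell r → ℝ) (Δ : Param r → ℝ) :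
    F π *ᵥ Δ = (G r)ᵀ *ᵥ (Omega π *ᵥ (G r *ᵥ Δ)) := by
  simp [F, Matrix.mulVec_mulVec, Matrix.mul_assoc]

theorem F_transpose (π : Cell r → ℝ) : (F π)ᵀ = F π := by
  have : (Omega π)ᵀ = Omega π := by
    ext x y
    simp [Omega, Matrix.vecMulVec_apply, Matrix.diagonal_apply, mul_comm, eq_comm]
    split_ifs with h
    · rw [h]
    · rfl
  simp [F, Matrix.transpose_mul, this, Matrix.mul_assoc]

theorem dotProduct_F_comm (π : Cell r → ℝ) (Δ Γ : Param r → ℝ) :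
    Δ ⬝ᵥ F π *ᵥ Γ = Γ ⬝ᵥ F π *ᵥ Δ := by
  rw [Matrix.dotProduct_mulVec, ← Matrix.mulVec_transpose, F_transpose, dotProduct_comm]

theorem dotProduct_F_self {π : Cell r → ℝ} (hπ : π ∈ Distr r) (Δ : Param r → ℝ) :
    Δ ⬝ᵥ F π *ᵥ Δ = ∑ x, π x * ((G r *ᵥ Δ) x - ∑ y, π y * (G r *ᵥ Δ) y) ^ 2 := by
  rw [F_mulVec, Matrix.dotProduct_mulVec, Matrix.vecMul_transpose, dotProduct]
  simp only [Omega_mulVec]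
  set f := G r *ᵥ Δ
  set m := ∑ y, π y * f y with hm
  have h0 : ∑ x, π x * (f x - m) = 0 := by
    simp only [mul_sub, Finset.sum_sub_distrib, ← Finset.sum_mul, hπ.2, one_mul, ← hm, sub_self]
  calc ∑ x, f x * (π x * (f x - m)) 
      = ∑ x, π x * (f x - m) ^ 2 + m * ∑ x, π x * (f x - m) := by
        rw [Finset.mul_sum, ← Finset.sum_add_distrib]
        exact Finset.sum_congr rfl fun x _ => by ring
    _ = _ := by rw [h0, mul_zero, add_zero]

theorem F_nonneg {π : Cell r → ℝ} (hπ : π ∈ Distr r) (Δ : Param r → ℝ) :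
    0 ≤ Δ ⬝ᵥ F π *ᵥ Δ := by
  rw [dotProduct_F_self hπ]
  exact Finset.sum_nonneg fun x _ => mul_nonneg (hπ.1 x).le (sq_nonneg _)

/-- The form is the variance of `G Δ`. Zero variance under full support makes `G Δ` constant, and
`contrast` sends constants to zero. -/
theorem eq_zero_of_F_self {π : Cell r → ℝ} (hπ : π ∈ Distr r) {Δ : Param r → ℝ}
    (h : Δ ⬝ᵥ F π *ᵥ Δ = 0) : Δ = 0 := by
  rw [dotProduct_F_self hπ, Finset.sum_eq_zero_iff_of_nonneg
    fun x _ => mul_nonneg (hπ.1 x).le (sq_nonneg _)] at h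
  have h1 : G r *ᵥ Δ = fun _ => ∑ y, π y * (G r *ᵥ Δ) y := by
    ext x
    have := h x (Finset.mem_univ _)
    rw [mul_eq_zero, sq_eq_zero_iff, sub_eq_zero] at this
    exact this.resolve_left (hπ.1 x).ne'
  rw [← contrast_G_mulVec Δ, h1, contrast_const]

theorem F_pos {π : Cell r → ℝ} (hπ : π ∈ Distr r) {Δ : Param r → ℝ} (h : Δ ≠ 0) :
    0 < Δ ⬝ᵥ F π *ᵥ Δ :=
  (F_nonneg hπ Δ).lt_of_ne fun h0 => h (eq_zero_of_F_self hπ h0.symm)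

/-! ### Secant form of the relation between `mu` and `eta` -/

theorem exists_logMean {a b : ℝ} (ha : 0 < a) (hb : 0 < b) :
    ∃ l, 0 < l ∧ a - b = l * (Real.log a - Real.log b) := by
  rcases lt_trichotomy a b with h | rfl | h
  · have := Real.log_lt_log ha h
    exact ⟨(a - b) / (Real.log a - Real.log b), div_pos_of_neg_of_neg (by linarith) (by linarith),
      (div_mul_cancel₀ _ (by linarith)).symm⟩
  · exact ⟨a, ha, by ring⟩
  · have := Real.log_lt_log hb h
    exact ⟨(a - b) / (Real.log a - Real.log b), div_pos (by linarith) (by linarith),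
      (div_mul_cancel₀ _ (by linarith)).symm⟩

theorem exists_of_logMean {l : ℝ} (hl : 0 < l) (u : ℝ) :
    ∃ a b : ℝ, 0 < a ∧ 0 < b ∧ Real.log a - Real.log b = u ∧ a - b = l * u := by
  rcases eq_or_ne u 0 with rfl | hu
  · exact ⟨l, l, hl, hl, by simp, by simp⟩
  · have hpos : 0 < u / (Real.exp u - 1) := by
      rcases hu.lt_or_gt with h | h
      · exact div_pos_of_neg_of_neg h (by linarith [Real.exp_lt_one_iff.2 h])
      · exact div_pos h (by linarith [Real.one_lt_exp_iff.2 h])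
    have hne : Real.exp u - 1 ≠ 0 := fun h => by simp [h] at hpos
    have hb : 0 < l * (u / (Real.exp u - 1)) := mul_pos hl hpos
    -- The ratio of the two numbers must be `exp u`, and their difference `l * u` then determines
    -- the smaller data.
    refine ⟨l * (u / (Real.exp u - 1)) * Real.exp u, _, mul_pos hb (Real.exp_pos _), hb, ?_, ?_⟩
    · rw [Real.log_mul hb.ne' (Real.exp_ne_zero _), Real.log_exp]
      ring
    · field_simp

/-- The difference of the mean parameters of two distributions is, up to a positive factor, the
covariance matrix of a third one applied to the difference of the log-linear parameters. -/
theorem exists_mu_sub_mu {π π' : Cell r → ℝ} (hπ : π ∈ Distr r) (hπ' : π' ∈ Distr r) :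
    ∃ p ∈ Distr r, ∃ c : ℝ, 0 < c ∧ mu π - mu π' = c • F p *ᵥ (eta π - eta π') := by
  choose l hl hlm using fun x => exists_logMean (hπ.1 x) (hπ'.1 x)
  obtain ⟨k, hk⟩ := exists_log_eq (π := π)
  obtain ⟨k', hk'⟩ := exists_log_eq (π := π')
  set c := ∑ x, l x with hc
  have hc0 : 0 < c := Finset.sum_pos (fun x _ => hl x) Finset.univ_nonempty
  -- The third distribution consists of the cellwise logarithmic means, normalised.
  refine ⟨fun x => l x / c, ⟨fun x => div_pos (hl x) hc0, ?_⟩, c, hc0, ?_⟩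
  · rw [← Finset.sum_div, ← hc, div_self hc0.ne']
  set Δ := eta π - eta π' with hΔ
  have hlog : ∀ x, Real.log (π x) - Real.log (π' x) = (k - k') + (G r *ᵥ Δ) x := fun x => by
    rw [hk, hk', hΔ, Matrix.mulVec_sub, Pi.sub_apply]
    ring
  -- Equal total masses force the difference of the normalising constants to be minus the mean of `G
  -- Δ`; this centring is what produces `Omega`.
  have hsum : ∑ x, l x / c * (G r *ᵥ Δ) x = -(k - k') := by
    have h0 : ∑ x, (π x - π' x) = 0 := by rw [Finset.sum_sub_distrib, hπ.2, hπ'.2, sub_self]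
    simp only [hlm, hlog, mul_add, Finset.sum_add_distrib, ← Finset.sum_mul, ← hc] at h0
    simp only [div_mul_eq_mul_div, ← Finset.sum_div]
    rw [div_eq_iff hc0.ne']
    linarith
  have hdiff : π - π' = c • (Omega (fun x => l x / c) *ᵥ (G r *ᵥ Δ)) := by
    ext x
    rw [Pi.sub_apply, Pi.smul_apply, Omega_mulVec, hsum, hlm, hlog, smul_eq_mul]
    field_simp
    ring
  rw [mu_eq, mu_eq, ← Matrix.mulVec_sub, hdiff, Matrix.mulVec_smul, F_mulVec]

/-- Converse of `exists_mu_sub_mu`: in each cell take a pair with logarithmic mean `p x` and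
log-ratio the centred `G Δ`. Centring gives both members the same total mass, so one normalisation
serves both. -/
theorem exists_eta_sub_eta {p : Cell r → ℝ} (hp : p ∈ Distr r) (Δ : Param r → ℝ) :
    ∃ π ∈ Distr r, ∃ π' ∈ Distr r, ∃ c : ℝ,
      eta π - eta π' = Δ ∧ mu π - mu π' = c • F p *ᵥ Δ := by
  set m := ∑ y, p y * (G r *ᵥ Δ) y with hm
  choose a b ha hb hlog hab using fun x => exists_of_logMean (hp.1 x) ((G r *ᵥ Δ) x - m)
  have hsum : ∑ x, (a x - b x) = 0 := by
    simp only [hab, mul_sub, Finset.sum_sub_distrib, ← Finset.sum_mul, hp.2, one_mul, ← hm,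
      sub_self]
  set c := ∑ x, a x with hc
  have hcb : ∑ x, b x = c := by
    rw [Finset.sum_sub_distrib] at hsum
    linarith
  have hc0 : 0 < c := Finset.sum_pos (fun x _ => ha x) Finset.univ_nonempty
  refine ⟨fun x => a x / c, ⟨fun x => div_pos (ha x) hc0, ?_⟩,
    fun x => b x / c, ⟨fun x => div_pos (hb x) hc0, ?_⟩, c⁻¹, ?_, ?_⟩
  · rw [← Finset.sum_div, ← hc, div_self hc0.ne']
  · rw [← Finset.sum_div, hcb, div_self hc0.ne']
  · have : (fun x => Real.log (a x / c)) - (fun x => Real.log (b x / c)) =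
        G r *ᵥ Δ - fun _ => m := by
      ext x
      simp only [Pi.sub_apply]
      rw [Real.log_div (ha x).ne' hc0.ne', Real.log_div (hb x).ne' hc0.ne', ← hlog]
      ring
    rw [eta_eq_contrast, eta_eq_contrast, ← map_sub, this, map_sub, contrast_G_mulVec,
      contrast_const, sub_zero]
  · have : (fun x => a x / c) - (fun x => b x / c) = c⁻¹ • (Omega p *ᵥ (G r *ᵥ Δ)) := by
      ext x
      rw [Pi.smul_apply, Omega_mulVec, ← hm, ← hab, smul_eq_mul, Pi.sub_apply]
      ring
    rw [mu_eq, mu_eq, ← Matrix.mulVec_sub, this, Matrix.mulVec_smul, F_mulVec]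

/-! ### Injectivity of mixed parameters -/

/-- The differential of `π ↦ (η_A, μ_B)` at `π` is injective. -/
def Nondegenerate (A B : Finset (Param r)) (π : Cell r → ℝ) : Prop :=
  ∀ Δ : Param r → ℝ, (∀ t ∈ A, Δ t = 0) → (∀ t ∈ B, (F π *ᵥ Δ) t = 0) → Δ = 0

/-- Nondegeneracy is needed at every `p`, since the intermediate distribution of the secant formula
is not known in advance. -/
theorem eq_of_nondegenerate {A B : Finset (Param r)} (h : ∀ p ∈ Distr r, Nondegenerate A B p)
    {π π' : Cell r → ℝ} (hπ : π ∈ Distr r) (hπ' : π' ∈ Distr r)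
    (hA : ∀ t ∈ A, eta π t = eta π' t) (hB : ∀ t ∈ B, mu π t = mu π' t) : π = π' := by
  obtain ⟨p, hp, c, hc, hmu⟩ := exists_mu_sub_mu hπ hπ'
  refine eta_injOn hπ hπ' (sub_eq_zero.1 (h p hp _ (fun t ht => ?_) fun t ht => ?_))
  · rw [Pi.sub_apply, hA t ht, sub_self]
  · have := congrFun hmu t
    rw [Pi.sub_apply, hB t ht, sub_self, Pi.smul_apply, smul_eq_mul, eq_comm, mul_eq_zero] at this
    exact this.resolve_left hc.ne'

theorem exists_ne_of_not_nondegenerate {A B : Finset (Param r)} {p : Cell r → ℝ}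
    (hp : p ∈ Distr r) (h : ¬ Nondegenerate A B p) :
    ∃ π ∈ Distr r, ∃ π' ∈ Distr r, π ≠ π' ∧ (∀ t ∈ A, eta π t = eta π' t) ∧
      ∀ t ∈ B, mu π t = mu π' t := by
  simp only [Nondegenerate, not_forall] at h
  obtain ⟨Δ, hA, hB, hΔ⟩ := h
  obtain ⟨π, hπ, π', hπ', c, heta, hmu⟩ := exists_eta_sub_eta hp Δ
  refine ⟨π, hπ, π', hπ', ?_, fun t ht => ?_, fun t ht => ?_⟩
  · rintro rfl
    exact hΔ (by rw [← heta, sub_self])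
  · rw [← sub_eq_zero, ← hA t ht, ← heta, Pi.sub_apply]
  · rw [← sub_eq_zero, ← Pi.sub_apply, hmu, Pi.smul_apply, hB t ht, smul_zero]

/-- Every term of `Δ ⬝ᵥ F π *ᵥ Δ` has a zero factor, so positive definiteness suffices. -/
theorem nondegenerate_of_cover {A B : Finset (Param r)} (hAB : ∀ t, t ∈ A ∨ t ∈ B)
    {π : Cell r → ℝ} (hπ : π ∈ Distr r) : Nondegenerate A B π := by
  intro Δ hA hB
  refine eq_zero_of_F_self hπ (Finset.sum_eq_zero fun t _ => ?_)
  rcases hAB t with ht | ht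
  · rw [hA t ht, zero_mul]
  · rw [hB t ht, mul_zero]

/-! ### Smoothness of the exponential family -/

theorem contDiff_G_mulVec (x : Cell r) : ContDiff ℝ ∞ fun θ : Param r → ℝ => (G r *ᵥ θ) x :=
  (LinearMap.toContinuousLinearMap ((LinearMap.proj x).comp (G r).mulVecLin)).contDiff

theorem contDiff_expFam : ContDiff ℝ ∞ (expFam (r := r)) :=
  contDiff_pi.2 fun x => (contDiff_G_mulVec x).exp.div
    (ContDiff.sum fun y _ => (contDiff_G_mulVec y).exp) fun _ => (sum_exp_pos _).ne'

theorem hasDerivAt_expFam_line (θ Δ : Param r → ℝ) (x : Cell r) :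
    HasDerivAt (fun s : ℝ => expFam (θ + s • Δ) x)
      ((Omega (expFam θ) *ᵥ (G r *ᵥ Δ)) x) 0 := by
  have h1 : ∀ y, HasDerivAt (fun s : ℝ => Real.exp ((G r *ᵥ (θ + s • Δ)) y))
      (Real.exp ((G r *ᵥ θ) y) * (G r *ᵥ Δ) y) 0 := by
    intro y
    have : HasDerivAt (fun s : ℝ => (G r *ᵥ (θ + s • Δ)) y) ((G r *ᵥ Δ) y) 0 := by
      simp only [Matrix.mulVec_add, Matrix.mulVec_smul, Pi.add_apply, Pi.smul_apply, smul_eq_mul]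
      simpa using ((hasDerivAt_id (0 : ℝ)).mul_const ((G r *ᵥ Δ) y)).const_add ((G r *ᵥ θ) y)
    simpa using this.exp
  have h2 := (h1 x).div (HasDerivAt.fun_sum (u := Finset.univ) fun y _ => h1 y)
    (sum_exp_pos _).ne'
  refine h2.congr_deriv ?_
  rw [Omega_mulVec]
  simp only [expFam, zero_smul, add_zero, div_mul_eq_mul_div, ← Finset.sum_div]
  have := (sum_exp_pos (G r *ᵥ θ)).ne'
  field_simp

theorem hasFDerivAt_mu_expFam (θ : Param r → ℝ) :
    HasFDerivAt (fun θ : Param r → ℝ => mu (expFam θ))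
      (LinearMap.toContinuousLinearMap (F (expFam θ)).mulVecLin) θ := by
  have h1 := (contDiff_expFam (r := r)).differentiable (by simp) θ |>.hasFDerivAt
  have h2 : ∀ Δ, fderiv ℝ expFam θ Δ = Omega (expFam θ) *ᵥ (G r *ᵥ Δ) := by
    intro Δ
    ext x
    have h3 : HasDerivAt (fun s : ℝ => expFam (θ + s • Δ) x) (fderiv ℝ expFam θ Δ x) 0 :=
      hasDerivAt_pi.1 (h1.hasLineDerivAt Δ) x
    exact h3.unique (hasDerivAt_expFam_line θ Δ x)
  have h4 := (LinearMap.toContinuousLinearMap (G r)ᵀ.mulVecLin).hasFDerivAt.comp θ h1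
  have h5 : LinearMap.toContinuousLinearMap (F (expFam θ)).mulVecLin =
      (LinearMap.toContinuousLinearMap (G r)ᵀ.mulVecLin).comp (fderiv ℝ expFam θ) :=
    ContinuousLinearMap.ext fun Δ =>
      (F_mulVec _ _).trans (congrArg ((G r)ᵀ *ᵥ ·) (h2 Δ).symm)
  rw [h5]
  exact h4

theorem contDiff_mu_expFam : ContDiff ℝ ∞ fun θ : Param r → ℝ => mu (expFam θ) :=
  (LinearMap.toContinuousLinearMap (G r)ᵀ.mulVecLin).contDiff.comp contDiff_expFam

theorem continuousOn_eta : ContinuousOn (eta (r := r)) {π | ∀ x, 0 < π x} := by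
  refine continuousOn_pi.2 fun t => continuousOn_finsetSum _ fun J _ => continuousOn_const.mul ?_
  exact ContinuousOn.log (continuous_apply _).continuousOn fun π hπ => (hπ _).ne'

/-! ### Existence in the mixed parametrization -/

/-- The log-partition function is coercive relative to the mean parameters of a strictly positive
distribution: the cross entropy of `π` and `expFam θ` is large outside a compact set of `θ`. -/
theorem exists_isCompact_crossEntropy {π : Cell r → ℝ} (hπ : π ∈ Distr r) (a : ℝ) :
    ∃ K : Set (Param r → ℝ), IsCompact K ∧
      ∀ θ, ∑ x, π x * -Real.log (expFam θ x) ≤ a → θ ∈ K := by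
  -- All terms of the cross entropy are nonnegative, so each log-probability is bounded by `|a| / π
  -- x`, and `θ` is the contrast of a bounded vector.
  set M := ∑ x, |a| / π x with hM
  have hMx : ∀ x, |a| / π x ≤ M := fun x =>
    Finset.single_le_sum (f := fun x => |a| / π x)
      (fun y _ => div_nonneg (abs_nonneg a) (hπ.1 y).le) (Finset.mem_univ x)
  have hM0 : 0 ≤ M := (div_nonneg (abs_nonneg a) (hπ.1 0).le).trans (hMx 0)
  refine ⟨LinearMap.toContinuousLinearMap (contrast r) '' Metric.closedBall 0 M,
    (isCompact_closedBall _ _).image (ContinuousLinearMap.continuous _), fun θ hθ => ?_⟩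
  refine ⟨fun x => Real.log (expFam θ x), ?_, eta_expFam θ⟩
  rw [mem_closedBall_zero_iff, pi_norm_le_iff_of_nonneg hM0]
  intro x
  have hlog : ∀ y, 0 ≤ -Real.log (expFam θ y) := fun y => by
    have h := expFam_mem θ
    have : expFam θ y ≤ 1 := h.2 ▸
      Finset.single_le_sum (fun z _ => (h.1 z).le) (Finset.mem_univ y)
    linarith [Real.log_nonpos (h.1 y).le this]
  have h1 : π x * -Real.log (expFam θ x) ≤ |a| :=
    (Finset.single_le_sum (f := fun x => π x * -Real.log (expFam θ x))
      (fun y _ => mul_nonneg (hπ.1 y).le (hlog y)) (Finset.mem_univ x)).trans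
      (hθ.trans (le_abs_self a))
  rw [Real.norm_eq_abs, ← abs_neg, abs_of_nonneg (hlog x)]
  refine le_trans ?_ (hMx x)
  rw [le_div_iff₀ (hπ.1 x), mul_comm]
  exact h1

/-- Stationarity of the cross entropy in the coordinate `t` is the matching of the mean parameter
`t`. -/
theorem hasDerivAt_crossEntropy_line {π : Cell r → ℝ} (hπ : π ∈ Distr r) (θ : Param r → ℝ)
    (t : Param r) :
    HasDerivAt (fun s : ℝ => ∑ x, π x * -Real.log (expFam (θ + s • Pi.single t 1) x))
      (mu (expFam θ) t - mu π t) 0 := by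
  have h := HasDerivAt.fun_sum (u := Finset.univ) fun x _ =>
    (((hasDerivAt_expFam_line θ (Pi.single t 1) x).log
      (by simpa using ((expFam_mem θ).1 x).ne')).neg).const_mul (π x)
  refine h.congr_deriv ?_
  have hq := expFam_mem θ
  have hG : G r *ᵥ (Pi.single t 1) = fun x => G r x t := by
    ext x
    simp
  simp only [Omega_mulVec, hG, zero_smul, add_zero, mu_eq]
  set m := ∑ y, expFam θ y * G r y t with hm
  have h1 : ((G r)ᵀ *ᵥ expFam θ) t = m := by
    rw [hm]
    exact Finset.sum_congr rfl fun x _ => mul_comm _ _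
  have h2 : ((G r)ᵀ *ᵥ π) t = ∑ x, π x * G r x t :=
    Finset.sum_congr rfl fun x _ => mul_comm _ _
  rw [h1, h2]
  have h3 : ∀ x, π x * -(expFam θ x * (G r x t - m) / expFam θ x) = π x * m - π x * G r x t :=
    fun x => by
      rw [mul_div_cancel_left₀ _ (hq.1 x).ne']
      ring
  simp only [h3]
  rw [Finset.sum_sub_distrib, ← Finset.sum_mul, hπ.2, one_mul]

/-- The mixed parametrization: the mean parameters in `S` of any strictly positive distribution can
be combined with arbitrary log-linear parameters outside `S`. -/
theorem exists_mixed (S : Finset (Param r)) {π : Cell r → ℝ} (hπ : π ∈ Distr r)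
    (θ₀ : Param r → ℝ) :
    ∃ θ : Param r → ℝ, (∀ t ∉ S, θ t = θ₀ t) ∧ ∀ t ∈ S, mu (expFam θ) t = mu π t := by
  set g : (Param r → ℝ) → ℝ := fun θ => ∑ x, π x * -Real.log (expFam θ x) with hg
  have hgc : Continuous g := continuous_finsetSum _ fun x _ => continuous_const.mul
    (((contDiff_pi.1 contDiff_expFam x).continuous.log fun θ => ((expFam_mem θ).1 x).ne').neg)
  obtain ⟨K, hK, hgK⟩ := exists_isCompact_crossEntropy hπ (g θ₀)
  set C : Set (Param r → ℝ) := {θ | ∀ t ∉ S, θ t = θ₀ t} with hC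
  have hCc : IsClosed C := by
    simp only [hC, Set.ofPred_forall]
    exact isClosed_iInter fun t => isClosed_iInter fun _ =>
      isClosed_eq (continuous_apply t) continuous_const
  have h0 : θ₀ ∈ K ∩ C := ⟨hgK _ le_rfl, fun _ _ => rfl⟩
  obtain ⟨θ, hθ, hmin⟩ := (hK.inter_right hCc).exists_isMinOn ⟨θ₀, h0⟩ hgc.continuousOn
  refine ⟨θ, hθ.2, fun t ht => ?_⟩
  -- The line stays in `C`. Outside `K` the value exceeds `g θ₀`, so the minimum over `K ∩ C` is a
  -- minimum over all of `C`.
  have hmin' : ∀ s : ℝ, g θ ≤ g (θ + s • Pi.single t 1) := by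
    intro s
    by_cases hs : g (θ + s • Pi.single t 1) ≤ g θ₀
    · refine hmin ⟨hgK _ hs, fun u hu => ?_⟩
      have hut : u ≠ t := fun h => hu (h ▸ ht)
      simp [hut, hθ.2 u hu]
    · exact (hmin h0).trans (not_le.1 hs).le
  have hloc : IsLocalMin (fun s : ℝ => g (θ + s • Pi.single t 1)) 0 :=
    Filter.Eventually.of_forall fun s => by simpa using hmin' s
  exact sub_eq_zero.1 (hloc.hasDerivAt_eq_zero (hasDerivAt_crossEntropy_line hπ θ t))

/-! ### Inverse function theorem for mixed parameters -/

/-- The log-linear parameters in `A` and the mean parameters in `B`, as functions of all the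
log-linear parameters. -/
noncomputable def etaMu (A B : Finset (Param r)) (θ : Param r → ℝ) : (A → ℝ) × (B → ℝ) :=
  (fun t => θ t.1, fun t => mu (expFam θ) t.1)

/-- The differential of `etaMu`. -/
noncomputable def etaMuDeriv (A B : Finset (Param r)) (π : Cell r → ℝ) :
    (Param r → ℝ) →L[ℝ] (A → ℝ) × (B → ℝ) :=
  LinearMap.toContinuousLinearMap
    ((LinearMap.funLeft ℝ ℝ (Subtype.val : A → Param r)).prod
      ((LinearMap.funLeft ℝ ℝ (Subtype.val : B → Param r)).comp (F π).mulVecLin))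

theorem hasFDerivAt_etaMu (A B : Finset (Param r)) (θ : Param r → ℝ) :
    HasFDerivAt (etaMu A B) (etaMuDeriv A B (expFam θ)) θ :=
  ((LinearMap.toContinuousLinearMap
      (LinearMap.funLeft ℝ ℝ (Subtype.val : A → Param r))).hasFDerivAt).prodMk
    ((LinearMap.toContinuousLinearMap
      (LinearMap.funLeft ℝ ℝ (Subtype.val : B → Param r))).hasFDerivAt.comp θ
        (hasFDerivAt_mu_expFam θ))

theorem contDiff_etaMu (A B : Finset (Param r)) : ContDiff ℝ ∞ (etaMu A B) :=
  ((LinearMap.toContinuousLinearMap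
      (LinearMap.funLeft ℝ ℝ (Subtype.val : A → Param r))).contDiff).prodMk
    ((LinearMap.toContinuousLinearMap
      (LinearMap.funLeft ℝ ℝ (Subtype.val : B → Param r))).contDiff.comp contDiff_mu_expFam)

theorem exists_equiv_of_nondegenerate {A B : Finset (Param r)}
    (hcard : A.card + B.card = Fintype.card (Param r)) {π : Cell r → ℝ}
    (h : Nondegenerate A B π) :
    ∃ e : (Param r → ℝ) ≃L[ℝ] (A → ℝ) × (B → ℝ),
      (e : (Param r → ℝ) →L[ℝ] (A → ℝ) × (B → ℝ)) = etaMuDeriv A B π := by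
  have hinj : LinearMap.ker (etaMuDeriv A B π).toLinearMap = ⊥ := by
    rw [LinearMap.ker_eq_bot']
    intro Δ hΔ
    have h1 := congrArg Prod.fst hΔ
    have h2 := congrArg Prod.snd hΔ
    exact h Δ (fun t ht => congrFun h1 ⟨t, ht⟩) fun t ht => congrFun h2 ⟨t, ht⟩
  have hfin : Module.finrank ℝ (Param r → ℝ) = Module.finrank ℝ ((A → ℝ) × (B → ℝ)) := by
    simp [Module.finrank_prod, hcard]
  refine ⟨(LinearEquiv.ofInjectiveOfFinrankEq (etaMuDeriv A B π).toLinearMap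
    (LinearMap.ker_eq_bot.1 hinj) hfin).toContinuousLinearEquiv, ?_⟩
  ext Δ : 1
  rfl

/-- By the dimension count, nondegeneracy is invertibility of a derivative that varies continuously.
-/
theorem isOpen_nondegenerate {A B : Finset (Param r)}
    (hcard : A.card + B.card = Fintype.card (Param r)) :
    IsOpen {θ : Param r → ℝ | Nondegenerate A B (expFam θ)} := by
  have hcont : Continuous fun θ : Param r → ℝ => etaMuDeriv A B (expFam θ) := by
    have := (contDiff_etaMu A B).continuous_fderiv (by simp)
    have h2 : fderiv ℝ (etaMu A B) = fun θ => etaMuDeriv A B (expFam θ) :=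
      funext fun θ => (hasFDerivAt_etaMu A B θ).fderiv
    rwa [h2] at this
  convert (ContinuousLinearEquiv.isOpen (𝕜 := ℝ) (E := Param r → ℝ)
    (F := (A → ℝ) × (B → ℝ))).preimage hcont using 1
  ext θ
  refine ⟨fun h => exists_equiv_of_nondegenerate hcard h, ?_⟩
  rintro ⟨e, he⟩ Δ hA hB
  refine e.injective ?_
  rw [map_zero, ← ContinuousLinearEquiv.coe_coe, he]
  exact Prod.ext (funext fun t => hA t.1 t.2) (funext fun t => hB t.1 t.2)

theorem isOpen_image_and_contDiffOn_invFunOn {E F : Type*} [NormedAddCommGroup E]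
    [NormedSpace ℝ E] [CompleteSpace E] [NormedAddCommGroup F] [NormedSpace ℝ F] {f : E → F}
    (hf : ContDiff ℝ ∞ f) {U : Set E} (hU : IsOpen U) (hinj : Set.InjOn f U)
    (hder : ∀ x ∈ U, ∃ e : E ≃L[ℝ] F, HasFDerivAt f (e : E →L[ℝ] F) x) :
    IsOpen (f '' U) ∧ ContDiffOn ℝ ∞ (Function.invFunOn f U) (f '' U) := by
  have key : ∀ x ∈ U, f '' U ∈ 𝓝 (f x) ∧ ContDiffAt ℝ ∞ (Function.invFunOn f U) (f x) := by
    intro x hx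
    obtain ⟨e, he⟩ := hder x hx
    have hfx := hf.contDiffAt (x := x)
    have hs := hfx.hasStrictFDerivAt' he (by simp)
    have h1 := hs.eventually_right_inverse
    have h2 : ∀ᶠ y in 𝓝 (f x), hs.localInverse f e x y ∈ U :=
      hs.localInverse_tendsto (hU.mem_nhds hx)
    -- The global inverse agrees with the local one: both preimages lie in `U`, where `f` is
    -- injective.
    have h3 : ∀ᶠ y in 𝓝 (f x), Function.invFunOn f U y = hs.localInverse f e x y := by
      filter_upwards [h1, h2] with y hy1 hy2
      have hy : y ∈ f '' U := ⟨_, hy2, hy1⟩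
      exact hinj (Function.invFunOn_mem hy) hy2 ((Function.invFunOn_eq hy).trans hy1.symm)
    refine ⟨?_, (hfx.to_localInverse he (by simp)).congr_of_eventuallyEq h3⟩
    filter_upwards [h1, h2] with y hy1 hy2
    exact ⟨_, hy2, hy1⟩
  constructor
  · rw [isOpen_iff_mem_nhds]
    rintro _ ⟨x, hx, rfl⟩
    exact (key x hx).1
  · rintro _ ⟨x, hx, rfl⟩
    exact (key x hx).2.contDiffWithinAt

theorem etaMu_isOpen_image_and_contDiffOn {A B : Finset (Param r)}
    (hcard : A.card + B.card = Fintype.card (Param r)) {U : Set (Param r → ℝ)} (hU : IsOpen U)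
    (hinj : Set.InjOn (etaMu A B) U) (hnd : ∀ θ ∈ U, Nondegenerate A B (expFam θ)) :
    IsOpen (etaMu A B '' U) ∧
      ContDiffOn ℝ ∞ (Function.invFunOn (etaMu A B) U) (etaMu A B '' U) := by
  refine isOpen_image_and_contDiffOn_invFunOn (contDiff_etaMu A B) hU hinj fun θ hθ => ?_
  obtain ⟨e, he⟩ := exists_equiv_of_nondegenerate hcard (hnd θ hθ)
  exact ⟨e, he ▸ hasFDerivAt_etaMu A B θ⟩

theorem exists_injOn_etaMu {A B : Finset (Param r)}
    (hcard : A.card + B.card = Fintype.card (Param r)) {θ : Param r → ℝ}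
    (h : Nondegenerate A B (expFam θ)) :
    ∃ U, IsOpen U ∧ θ ∈ U ∧ Set.InjOn (etaMu A B) U ∧
      ∀ θ' ∈ U, Nondegenerate A B (expFam θ') := by
  obtain ⟨e, he⟩ := exists_equiv_of_nondegenerate hcard h
  have h1 : HasFDerivAt (etaMu A B) (e : (Param r → ℝ) →L[ℝ] (A → ℝ) × (B → ℝ)) θ :=
    he ▸ hasFDerivAt_etaMu A B θ
  have hs := (contDiff_etaMu A B).contDiffAt.hasStrictFDerivAt' h1 (by simp)
  exact ⟨(hs.toOpenPartialHomeomorph (etaMu A B)).source ∩ {θ | Nondegenerate A B (expFam θ)},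
    (hs.toOpenPartialHomeomorph _).open_source.inter (isOpen_nondegenerate hcard),
    ⟨hs.mem_toOpenPartialHomeomorph_source, h⟩,
    (hs.toOpenPartialHomeomorph _).injOn.mono Set.inter_subset_left, fun _ h => h.2⟩

theorem injective_etaMu {A B : Finset (Param r)} (h : ∀ p ∈ Distr r, Nondegenerate A B p) :
    Function.Injective (etaMu A B) := by
  intro θ θ' heq
  have := eq_of_nondegenerate h (expFam_mem θ) (expFam_mem θ')
    (fun t ht => by
      rw [eta_expFam, eta_expFam]
      exact congrFun (congrArg Prod.fst heq) ⟨t, ht⟩)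
    fun t ht => congrFun (congrArg Prod.snd heq) ⟨t, ht⟩
  rw [← eta_expFam θ, this, eta_expFam]

theorem xi_eq_etaMu (V I H : Finset (Param r)) {π : Cell r → ℝ} (hπ : π ∈ Distr r) :
    xi V I H π = etaMu (freeEta V I H) V (eta π) := by
  rw [etaMu, expFam_eta hπ, xi]

theorem smoothOneToOneOn_image {V I H : Finset (Param r)}
    (hcard : (freeEta V I H).card + V.card = Fintype.card (Param r)) {U : Set (Param r → ℝ)}
    (hU : IsOpen U) (hinj : Set.InjOn (etaMu (freeEta V I H) V) U)
    (hnd : ∀ θ ∈ U, Nondegenerate (freeEta V I H) V (expFam θ)) :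
    SmoothOneToOneOn V I H (expFam '' U) := by
  obtain ⟨h1, h2⟩ := etaMu_isOpen_image_and_contDiffOn hcard hU hinj hnd
  have hxi : ∀ θ, xi V I H (expFam θ) = etaMu (freeEta V I H) V θ := fun θ => by
    rw [xi_eq_etaMu V I H (expFam_mem θ), eta_expFam]
  have him : xi V I H '' (expFam '' U) = etaMu (freeEta V I H) V '' U := by
    rw [Set.image_image]
    exact Set.image_congr fun θ _ => hxi θ
  refine ⟨?_, him ▸ h1, expFam ∘ Function.invFunOn (etaMu (freeEta V I H) V) U,
    him ▸ contDiff_expFam.comp_contDiffOn h2, ?_⟩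
  · rintro _ ⟨θ, hθ, rfl⟩ _ ⟨θ', hθ', rfl⟩ h
    rw [hxi, hxi] at h
    rw [hinj hθ hθ' h]
  · rintro _ ⟨θ, hθ, rfl⟩
    rw [hxi, Function.comp_apply, hinj.leftInvOn_invFunOn hθ]

theorem distr_inter_eta_preimage (U : Set (Param r → ℝ)) :
    Distr r ∩ ({π | ∀ x, 0 < π x} ∩ eta ⁻¹' U) = expFam '' U := by
  ext π
  constructor
  · rintro ⟨hπ, -, hU⟩
    exact ⟨eta π, hU, expFam_eta hπ⟩
  · rintro ⟨θ, hθ, rfl⟩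
    exact ⟨expFam_mem θ, (expFam_mem θ).1, by simpa using hθ⟩

theorem smoothOneToOneOn_near {V I H : Finset (Param r)}
    (hcard : (freeEta V I H).card + V.card = Fintype.card (Param r)) {π : Cell r → ℝ}
    (hπ : π ∈ Distr r) (h : Nondegenerate (freeEta V I H) V π) :
    ∃ U : Set (Cell r → ℝ), IsOpen U ∧ π ∈ U ∧ SmoothOneToOneOn V I H (Distr r ∩ U) := by
  rw [← expFam_eta hπ] at h
  obtain ⟨U, hU, hmem, hinj, hnd⟩ := exists_injOn_etaMu hcard h
  -- The positive orthant is included because `eta` is continuous there, which makes the preimage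
  -- open in the whole space of arrays.
  refine ⟨{π | ∀ x, 0 < π x} ∩ eta ⁻¹' U, continuousOn_eta.isOpen_inter_preimage ?_ hU,
    ⟨hπ.1, hmem⟩, ?_⟩
  · simp only [Set.ofPred_forall]
    exact isOpen_iInter_of_finite fun x => isOpen_lt continuous_const (continuous_apply x)
  · rw [distr_inter_eta_preimage]
    exact smoothOneToOneOn_image hcard hU hinj hnd

theorem smoothOneToOneOn_distr {V I H : Finset (Param r)}
    (hcard : (freeEta V I H).card + V.card = Fintype.card (Param r))
    (h : ∀ p ∈ Distr r, Nondegenerate (freeEta V I H) V p) :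
    SmoothOneToOneOn V I H (Distr r) := by
  have hD : Distr r = expFam '' (Set.univ : Set (Param r → ℝ)) := by
    ext π
    refine ⟨fun hπ => ⟨eta π, trivial, expFam_eta hπ⟩, ?_⟩
    rintro ⟨θ, -, rfl⟩
    exact expFam_mem θ
  rw [hD]
  exact smoothOneToOneOn_image hcard isOpen_univ (injective_etaMu h).injOn
    fun θ _ => h _ (expFam_mem θ)

/-! ### Schur complements of the covariance matrix -/

theorem Fblock_mulVec_add {K T : Finset (Param r)} (hKT : Disjoint K T) (π : Cell r → ℝ)
    {Δ : Param r → ℝ} (hsupp : ∀ t, t ∉ K → t ∉ T → Δ t = 0) (S : Finset (Param r)) (s : S) :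
    (F π *ᵥ Δ) s.1 = (Fblock π S K *ᵥ fun t => Δ t.1) s + (Fblock π S T *ᵥ fun t => Δ t.1) s := by
  have h1 : (F π *ᵥ Δ) s.1 = ∑ t ∈ K ∪ T, F π s.1 t * Δ t := by
    refine (Finset.sum_subset (Finset.subset_univ _) fun t _ ht => ?_).symm
    rw [Finset.mem_union, not_or] at ht
    rw [hsupp t ht.1 ht.2, mul_zero]
  rw [h1, Finset.sum_union hKT, ← Finset.sum_coe_sort K, ← Finset.sum_coe_sort T]
  rfl

theorem dotProduct_eq_of_supp {K T : Finset (Param r)}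
    {Δ Γ : Param r → ℝ} (hsupp : ∀ t, t ∉ K → t ∉ T → Δ t = 0) (hK : ∀ t ∈ K, Γ t = 0) :
    Δ ⬝ᵥ Γ = (fun t : T => Δ t.1) ⬝ᵥ fun t : T => Γ t.1 := by
  simp only [dotProduct]
  rw [Finset.sum_coe_sort T fun t => Δ t * Γ t]
  refine (Finset.sum_subset (Finset.subset_univ _) fun t _ ht => ?_).symm
  by_cases h : t ∈ K
  · rw [hK t h, mul_zero]
  · rw [hsupp t h ht, zero_mul]

theorem isUnit_det_Fblock {π : Cell r → ℝ} (hπ : π ∈ Distr r) (K : Finset (Param r)) :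
    IsUnit (Fblock π K K).det := by
  rw [← Matrix.isUnit_iff_isUnit_det, ← Matrix.mulVec_injective_iff_isUnit]
  refine (injective_iff_map_eq_zero (Fblock π K K).mulVecLin).2 fun w hw => ?_
  set Δ : Param r → ℝ := fun t => if h : t ∈ K then w ⟨t, h⟩ else 0 with hΔ
  have hsupp : ∀ t, t ∉ K → t ∉ (∅ : Finset (Param r)) → Δ t = 0 := fun t ht _ => by
    simp [hΔ, ht]
  have hres : (fun t : K => Δ t.1) = w := by
    ext t
    simp [hΔ]
  have hK : ∀ t ∈ K, (F π *ᵥ Δ) t = 0 := by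
    intro t ht
    have h := Fblock_mulVec_add (Finset.disjoint_empty_right K) π hsupp K ⟨t, ht⟩
    rw [hres] at h
    have h2 := congrFun hw ⟨t, ht⟩
    rw [Matrix.mulVecLin_apply] at h2
    rw [h, h2]
    simp [Matrix.mulVec, dotProduct]
  have h0 : Δ = 0 := by
    refine eq_zero_of_F_self hπ ?_
    rw [dotProduct_eq_of_supp hsupp hK]
    simp [dotProduct]
  rw [← hres, h0]
  rfl

/-- If `Δ` is supported on `K ∪ T` and `F Δ` vanishes on `K`, then `F Δ` is given by the Schur
complement with respect to `K`. -/
theorem F_mulVec_eq_Fcond {K T : Finset (Param r)} (hKT : Disjoint K T) {π : Cell r → ℝ}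
    (hπ : π ∈ Distr r) {Δ : Param r → ℝ} (hsupp : ∀ t, t ∉ K → t ∉ T → Δ t = 0)
    (hK : ∀ t ∈ K, (F π *ᵥ Δ) t = 0) (S : Finset (Param r)) (s : S) :
    (F π *ᵥ Δ) s.1 = (Fcond π S T K *ᵥ fun t => Δ t.1) s := by
  have hu := isUnit_det_Fblock hπ K
  have h1 : Fblock π K K *ᵥ (fun t => Δ t.1) = -(Fblock π K T *ᵥ fun t => Δ t.1) := by
    ext k
    have h := Fblock_mulVec_add hKT π hsupp K k
    rw [hK k.1 k.2] at h
    rw [Pi.neg_apply]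
    linarith
  have h2 : (fun t : K => Δ t.1) =
      -((Fblock π K K)⁻¹ *ᵥ (Fblock π K T *ᵥ fun t => Δ t.1)) := by
    rw [← Matrix.mulVec_neg, ← h1, Matrix.mulVec_mulVec, Matrix.nonsing_inv_mul _ hu,
      Matrix.one_mulVec]
  rw [Fblock_mulVec_add hKT π hsupp S s, h2, Fcond, Matrix.sub_mulVec, Matrix.mulVec_neg,
    Matrix.mulVec_mulVec, Matrix.mulVec_mulVec, Pi.sub_apply, Pi.neg_apply, Matrix.mul_assoc]
  ring

/-- The part on `K` is found by solving `F Δ = 0` there. With `F_mulVec_eq_Fcond`, statements about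
Schur complements become statements about `F` on such extensions. -/
theorem exists_of_Fcond {K T : Finset (Param r)} (hKT : Disjoint K T) {π : Cell r → ℝ}
    (hπ : π ∈ Distr r) (v : T → ℝ) :
    ∃ Δ : Param r → ℝ, (∀ t, t ∉ K → t ∉ T → Δ t = 0) ∧ (∀ t ∈ K, (F π *ᵥ Δ) t = 0) ∧
      (fun t : T => Δ t.1) = v := by
  set w : K → ℝ := -((Fblock π K K)⁻¹ *ᵥ (Fblock π K T *ᵥ v)) with hw
  set Δ : Param r → ℝ := fun t =>
    if h : t ∈ T then v ⟨t, h⟩ else if h : t ∈ K then w ⟨t, h⟩ else 0 with hΔ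
  have hsupp : ∀ t, t ∉ K → t ∉ T → Δ t = 0 := fun t h1 h2 => by simp [hΔ, h1, h2]
  have hT : (fun t : T => Δ t.1) = v := by
    ext t
    simp [hΔ]
  have hKw : (fun t : K => Δ t.1) = w := by
    ext t
    simp [hΔ, Finset.disjoint_left.1 hKT t.2]
  refine ⟨Δ, hsupp, fun t ht => ?_, hT⟩
  rw [Fblock_mulVec_add hKT π hsupp K ⟨t, ht⟩, hT, hKw, hw, Matrix.mulVec_neg,
    Matrix.mulVec_mulVec, Matrix.mul_nonsing_inv _ (isUnit_det_Fblock hπ K), Matrix.one_mulVec]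
  simp

theorem Fblock_transpose (π : Cell r → ℝ) (S T : Finset (Param r)) :
    (Fblock π S T)ᵀ = Fblock π T S := by
  rw [Fblock, Matrix.transpose_submatrix, F_transpose, Fblock]

theorem Fcond_transpose (π : Cell r → ℝ) (S T K : Finset (Param r)) :
    (Fcond π S T K)ᵀ = Fcond π T S K := by
  simp [Fcond, Matrix.transpose_mul, Matrix.transpose_nonsing_inv, Fblock_transpose,
    Matrix.mul_assoc]

theorem Fcond_self_pos {K T : Finset (Param r)} (hKT : Disjoint K T) {π : Cell r → ℝ}
    (hπ : π ∈ Distr r) {v : T → ℝ} (hv : v ≠ 0) : 0 < v ⬝ᵥ Fcond π T T K *ᵥ v := by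
  obtain ⟨Δ, hsupp, hK, hΔ⟩ := exists_of_Fcond hKT hπ v
  have h : v ⬝ᵥ Fcond π T T K *ᵥ v = Δ ⬝ᵥ F π *ᵥ Δ := by
    rw [dotProduct_eq_of_supp hsupp hK, hΔ]
    congr 1
    ext t
    rw [F_mulVec_eq_Fcond hKT hπ hsupp hK T t, hΔ]
  rw [h]
  refine F_pos hπ ?_
  rintro rfl
  exact hv hΔ.symm

theorem posDef_Fcond {K T : Finset (Param r)} (hKT : Disjoint K T) {π : Cell r → ℝ}
    (hπ : π ∈ Distr r) : (Fcond π T T K).PosDef :=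
  Matrix.PosDef.of_dotProduct_mulVec_pos
    (by rw [Matrix.IsHermitian, Matrix.conjTranspose_eq_transpose_of_trivial, Fcond_transpose])
    fun v hv => by simpa using Fcond_self_pos hKT hπ hv

/-! ### `Q`, the differential of `xi`, and contraction by `J` -/

section Setup

variable {V I H : Finset (Param r)}

theorem mem_freeEta_iff {t : Param r} : t ∈ freeEta V I H ↔ t ∉ V \ I ∧ t ∉ H := by
  simp only [freeEta, Finset.mem_sdiff, Finset.mem_union, Finset.mem_compl]
  tauto

theorem disjoint_sdiff_H (hH : Disjoint H V) : Disjoint (V \ I) H :=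
  (hH.mono_right Finset.sdiff_subset).symm

theorem card_freeEta_add_card (hI : I ⊆ V) (hH : Disjoint H V) (hcard : I.card = H.card) :
    (freeEta V I H).card + V.card = Fintype.card (Param r) := by
  have h1 : freeEta V I H = (V \ I ∪ H)ᶜ := by
    ext t
    rw [mem_freeEta_iff]
    simp
  have h2 := Finset.card_compl_add_card (V \ I ∪ H)
  rw [← h1, Finset.card_union_of_disjoint (disjoint_sdiff_H hH), Finset.card_sdiff_of_subset hI]
    at h2
  have := Finset.card_le_card hI
  omega

/-- A kernel vector of the differential lives on `R ∪ H` with `F Δ = 0` on `R`, so its effect on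
`μ_I` is `Q` applied to its `H` part. If that part is zero, so is the variance. -/
theorem nondegenerate_iff (hI : I ⊆ V) (hH : Disjoint H V) {π : Cell r → ℝ}
    (hπ : π ∈ Distr r) :
    Nondegenerate (freeEta V I H) V π ↔ ∀ v, Q V I H π *ᵥ v = 0 → v = 0 := by
  have hd := disjoint_sdiff_H (I := I) hH
  constructor
  · intro h v hv
    obtain ⟨Δ, hsupp, hK, hΔ⟩ := exists_of_Fcond hd hπ v
    have h0 : Δ = 0 := by
      refine h Δ (fun t ht => ?_) fun t ht => ?_
      · rw [mem_freeEta_iff] at ht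
        exact hsupp t ht.1 ht.2
      · by_cases hti : t ∈ I
        · rw [F_mulVec_eq_Fcond hd hπ hsupp hK I ⟨t, hti⟩, hΔ]
          exact congrFun hv ⟨t, hti⟩
        · exact hK t (Finset.mem_sdiff.2 ⟨ht, hti⟩)
    rw [← hΔ, h0]
    rfl
  · intro h Δ hA hB
    have hsupp : ∀ t, t ∉ V \ I → t ∉ H → Δ t = 0 := fun t h1 h2 =>
      hA t ((mem_freeEta_iff).2 ⟨h1, h2⟩)
    have hK : ∀ t ∈ V \ I, (F π *ᵥ Δ) t = 0 := fun t ht => hB t (Finset.mem_sdiff.1 ht).1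
    have h0 := h (fun t => Δ t.1) (by
      ext t
      rw [Q, ← F_mulVec_eq_Fcond hd hπ hsupp hK I t]
      exact hB t.1 (hI t.2))
    refine eq_zero_of_F_self hπ ?_
    rw [dotProduct_eq_of_supp hsupp hK, h0, zero_dotProduct]

theorem rank_Q_eq_iff (hcard : I.card = H.card) {π : Cell r → ℝ} :
    (Q V I H π).rank = I.card ↔ ∀ v, Q V I H π *ᵥ v = 0 → v = 0 := by
  have h := LinearMap.finrank_range_add_finrank_ker (Q V I H π).mulVecLin
  rw [Module.finrank_fintype_fun_eq_card, Fintype.card_coe] at h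
  change (Q V I H π).rank + _ = _ at h
  have h2 : (∀ v, Q V I H π *ᵥ v = 0 → v = 0) ↔ LinearMap.ker (Q V I H π).mulVecLin = ⊥ := by
    rw [LinearMap.ker_eq_bot']
    rfl
  rw [h2, ← Submodule.finrank_eq_zero (R := ℝ)]
  omega

/-- `Δ` and `Γ` extend `v` with respect to `R` and `V`. Their difference is supported on `V`, where
`F Γ` vanishes, so it is `F`-orthogonal to `Γ`, and the two forms differ by its squared `F`-norm. -/
theorem dotProduct_Fcond_sub (hH : Disjoint H V) {π : Cell r → ℝ} (hπ : π ∈ Distr r)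
    (v : H → ℝ) :
    ∃ Δ Γ : Param r → ℝ, v ⬝ᵥ Fcond π H H (V \ I) *ᵥ v - v ⬝ᵥ Fcond π H H V *ᵥ v =
        (Δ - Γ) ⬝ᵥ F π *ᵥ (Δ - Γ) ∧
      (∀ t : H, (F π *ᵥ Δ) t.1 = (Fcond π H H (V \ I) *ᵥ v) t) ∧
      (∀ t : H, (F π *ᵥ Γ) t.1 = (Fcond π H H V *ᵥ v) t) ∧
      (∀ t : I, (F π *ᵥ Δ) t.1 = (Q V I H π *ᵥ v) t) ∧
      (∀ t ∈ V \ I, (F π *ᵥ Δ) t = 0) ∧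
      (∀ t ∈ V, (F π *ᵥ Γ) t = 0) ∧
      (∀ t, t ∉ V \ I → t ∉ H → Δ t = 0) ∧
      (∀ t, t ∉ V → t ∉ H → Γ t = 0) ∧
      (fun t : H => Δ t.1) = v ∧ (fun t : H => Γ t.1) = v := by
  have hd := disjoint_sdiff_H (I := I) hH
  obtain ⟨Δ, hΔs, hΔK, hΔ⟩ := exists_of_Fcond hd hπ v
  obtain ⟨Γ, hΓs, hΓK, hΓ⟩ := exists_of_Fcond hH.symm hπ v
  have hA : ∀ t : H, (F π *ᵥ Δ) t.1 = (Fcond π H H (V \ I) *ᵥ v) t := fun t => by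
    rw [F_mulVec_eq_Fcond hd hπ hΔs hΔK H t, hΔ]
  have hB : ∀ t : H, (F π *ᵥ Γ) t.1 = (Fcond π H H V *ᵥ v) t := fun t => by
    rw [F_mulVec_eq_Fcond hH.symm hπ hΓs hΓK H t, hΓ]
  refine ⟨Δ, Γ, ?_, hA, hB, fun t => ?_, hΔK, hΓK, hΔs, hΓs, hΔ, hΓ⟩
  · have hΔs' : ∀ t, t ∉ V → t ∉ H → Δ t = 0 := fun t h1 h2 =>
      hΔs t (fun h => h1 (Finset.mem_sdiff.1 h).1) h2
    have e1 : Δ ⬝ᵥ F π *ᵥ Δ = v ⬝ᵥ Fcond π H H (V \ I) *ᵥ v := by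
      rw [dotProduct_eq_of_supp hΔs hΔK, hΔ, funext hA]
    have e2 : Δ ⬝ᵥ F π *ᵥ Γ = v ⬝ᵥ Fcond π H H V *ᵥ v := by
      rw [dotProduct_eq_of_supp hΔs' hΓK, hΔ, funext hB]
    have e3 : Γ ⬝ᵥ F π *ᵥ Γ = v ⬝ᵥ Fcond π H H V *ᵥ v := by
      rw [dotProduct_eq_of_supp hΓs hΓK, hΓ, funext hB]
    rw [Matrix.mulVec_sub, dotProduct_sub, sub_dotProduct, sub_dotProduct, e1, e2, e3,
      dotProduct_F_comm, e2]
    ring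
  · rw [F_mulVec_eq_Fcond hd hπ hΔs hΔK I t, hΔ, Q]

theorem dotProduct_Fcond_lt (hI : I ⊆ V) (hH : Disjoint H V) {π : Cell r → ℝ}
    (hπ : π ∈ Distr r) {v : H → ℝ} (hv : Q V I H π *ᵥ v ≠ 0) :
    v ⬝ᵥ Fcond π H H V *ᵥ v < v ⬝ᵥ Fcond π H H (V \ I) *ᵥ v := by
  obtain ⟨Δ, Γ, h, -, -, hQ, -, hΓV, -⟩ := dotProduct_Fcond_sub (I := I) hH hπ v
  have : 0 < (Δ - Γ) ⬝ᵥ F π *ᵥ (Δ - Γ) := by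
    refine F_pos hπ fun h0 => hv ?_
    ext t
    rw [← hQ t, sub_eq_zero.1 h0]
    exact hΓV t.1 (hI t.2)
  linarith

/-- If `Q v = 0`, then `F Δ` vanishes on all of `V`, so the two extensions of `v` coincide. -/
theorem Fcond_mulVec_eq_of_Q_mulVec (hH : Disjoint H V) {π : Cell r → ℝ}
    (hπ : π ∈ Distr r) {v : H → ℝ} (hv : Q V I H π *ᵥ v = 0) :
    Fcond π H H V *ᵥ v = Fcond π H H (V \ I) *ᵥ v := by
  obtain ⟨Δ, Γ, -, hA, hB, hQ, hΔR, hΓV, hΔs, hΓs, hΔ, hΓ⟩ := dotProduct_Fcond_sub (I := I) hH hπ v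
  have h0 : Δ - Γ = 0 := by
    refine nondegenerate_of_cover (A := Vᶜ) (B := V) (fun t => ?_) hπ _ (fun t ht => ?_)
      fun t ht => ?_
    · rw [Finset.mem_compl]
      tauto
    · rw [Finset.mem_compl] at ht
      by_cases htH : t ∈ H
      · have h1 := congrFun hΔ ⟨t, htH⟩
        have h2 := congrFun hΓ ⟨t, htH⟩
        rw [Pi.sub_apply, sub_eq_zero]
        exact h1.trans h2.symm
      · rw [Pi.sub_apply, hΓs t ht htH, hΔs t (fun h => ht (Finset.mem_sdiff.1 h).1) htH, sub_zero]
    · rw [Matrix.mulVec_sub, Pi.sub_apply, hΓV t ht, sub_zero]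
      by_cases hti : t ∈ I
      · rw [hQ ⟨t, hti⟩, hv]
        rfl
      · exact hΔR t (Finset.mem_sdiff.2 ⟨ht, hti⟩)
  ext t
  rw [← hA, ← hB, sub_eq_zero.1 h0]

theorem Fcond_mul_Jac (hH : Disjoint H V) {π : Cell r → ℝ} (hπ : π ∈ Distr r) :
    Fcond π H H (V \ I) * Jac V I H π = Fcond π H H V := by
  have hu : IsUnit (Fcond π H H (V \ I)).det :=
    (Matrix.isUnit_iff_isUnit_det _).1 (posDef_Fcond (disjoint_sdiff_H hH) hπ).isUnit
  rw [Jac, ← Matrix.mul_assoc, Matrix.mul_nonsing_inv _ hu, Matrix.one_mul]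

theorem Fcond_inv_mulVec (hH : Disjoint H V) {π : Cell r → ℝ} (hπ : π ∈ Distr r) (v : H → ℝ) :
    (Fcond π H H (V \ I))⁻¹ *ᵥ (Fcond π H H (V \ I) *ᵥ v) = v := by
  have hu : IsUnit (Fcond π H H (V \ I)).det :=
    (Matrix.isUnit_iff_isUnit_det _).1 (posDef_Fcond (disjoint_sdiff_H hH) hπ).isUnit
  rw [Matrix.mulVec_mulVec, Matrix.nonsing_inv_mul _ hu, Matrix.one_mulVec]

theorem Jac_mulVec_of_Q_mulVec (hH : Disjoint H V) {π : Cell r → ℝ} (hπ : π ∈ Distr r)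
    {v : H → ℝ} (hv : Q V I H π *ᵥ v = 0) : Jac V I H π *ᵥ v = v := by
  rw [Jac, ← Matrix.mulVec_mulVec, Fcond_mulVec_eq_of_Q_mulVec hH hπ hv, Fcond_inv_mulVec hH hπ]

/-- With `w = J v` one has `A w = B v`. Expanding `0 ≤ (v - w)'B(v - w)` and using `w'Bw ≤ w'Aw =
w'Bv` gives `w'Aw ≤ v'Bv < v'Av`. -/
theorem Jac_contracts (hI : I ⊆ V) (hH : Disjoint H V) {π : Cell r → ℝ} (hπ : π ∈ Distr r)
    {v : H → ℝ} (hv : Q V I H π *ᵥ v ≠ 0) :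
    (Jac V I H π *ᵥ v) ⬝ᵥ Fcond π H H (V \ I) *ᵥ (Jac V I H π *ᵥ v) <
      v ⬝ᵥ Fcond π H H (V \ I) *ᵥ v := by
  set A := Fcond π H H (V \ I) with hA
  set B := Fcond π H H V with hB
  set w := Jac V I H π *ᵥ v with hw
  have hAw : A *ᵥ w = B *ᵥ v := by rw [hw, Matrix.mulVec_mulVec, Fcond_mul_Jac hH hπ]
  have hle : ∀ u : H → ℝ, u ⬝ᵥ B *ᵥ u ≤ u ⬝ᵥ A *ᵥ u := by
    intro u
    obtain ⟨Δ, Γ, h, -⟩ := dotProduct_Fcond_sub (I := I) hH hπ u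
    have := F_nonneg hπ (Δ - Γ)
    linarith
  have hpos : 0 ≤ (v - w) ⬝ᵥ B *ᵥ (v - w) := by
    simpa using (posDef_Fcond hH.symm hπ).posSemidef.dotProduct_mulVec_nonneg (v - w)
  have hsymm : v ⬝ᵥ B *ᵥ w = w ⬝ᵥ B *ᵥ v := by
    rw [Matrix.dotProduct_mulVec, ← Matrix.mulVec_transpose, hB, Fcond_transpose, dotProduct_comm]
  have hlt := dotProduct_Fcond_lt hI hH hπ hv
  have hww := hle w
  rw [Matrix.mulVec_sub, dotProduct_sub, sub_dotProduct, sub_dotProduct, hsymm] at hpos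
  rw [hAw] at hww ⊢
  linarith

end Setup

/-! ### Rates of convergence at a fixed point -/

theorem exists_le_mul_of_homogeneous {E : Type*} [NormedAddCommGroup E] [NormedSpace ℝ E]
    [FiniteDimensional ℝ E] {f g : E → ℝ} (hf : Continuous f) (hg : Continuous g)
    (hf0 : ∀ v, 0 ≤ f v) (hfs : ∀ (a : ℝ) v, f (a • v) = |a| * f v)
    (hgs : ∀ (a : ℝ) v, g (a • v) = |a| * g v) (hpos : ∀ v, v ≠ 0 → 0 < g v) :
    ∃ K, 0 ≤ K ∧ (∀ v, f v ≤ K * g v) ∧ (K = 0 ∨ ∃ v, v ≠ 0 ∧ f v = K * g v) := by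
  have hf00 : f 0 = 0 := by simpa using hfs 0 0
  have hg00 : g 0 = 0 := by simpa using hgs 0 0
  rcases subsingleton_or_nontrivial E with hE | hE
  · refine ⟨0, le_rfl, fun v => ?_, Or.inl rfl⟩
    rw [Subsingleton.elim v 0, hf00, zero_mul]
  have hne : (Metric.sphere (0 : E) 1).Nonempty := NormedSpace.sphere_nonempty.2 zero_le_one
  have hs : ∀ v ∈ Metric.sphere (0 : E) 1, v ≠ 0 := fun v hv h => by
    rw [h] at hv
    simp at hv
  obtain ⟨v₀, hv₀, hmax⟩ := (isCompact_sphere (0 : E) 1).exists_isMaxOn hne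
    (hf.continuousOn.div hg.continuousOn fun v hv => (hpos v (hs v hv)).ne')
  have h0 := hpos v₀ (hs v₀ hv₀)
  -- The constant is attained, so that a strict pointwise inequality will later force it below one.
  refine ⟨f v₀ / g v₀, div_nonneg (hf0 _) h0.le, fun v => ?_,
    Or.inr ⟨v₀, hs v₀ hv₀, (div_mul_cancel₀ _ h0.ne').symm⟩⟩
  rcases eq_or_ne v 0 with rfl | hv
  · rw [hf00, hg00, mul_zero]
  · have hn := norm_pos_iff.2 hv
    have hmem : ‖v‖⁻¹ • v ∈ Metric.sphere (0 : E) 1 := by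
      rw [mem_sphere_zero_iff_norm, norm_smul, norm_inv, norm_norm, inv_mul_cancel₀ hn.ne']
    have h1 : f (‖v‖⁻¹ • v) / g (‖v‖⁻¹ • v) ≤ f v₀ / g v₀ := hmax hmem
    rw [hfs, hgs, mul_div_mul_left _ _ (by positivity), div_le_iff₀ (hpos v hv)] at h1
    exact h1

/-- Local linear convergence at a fixed point at which the derivative is a strict contraction for
some norm. -/
theorem exists_geometric_rate {E : Type*} [NormedAddCommGroup E] [NormedSpace ℝ E]
    [FiniteDimensional ℝ E] {T : E → E} {J : E →L[ℝ] E} {x : E} (hT : HasFDerivAt T J x)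
    (hx : T x = x) (N : Seminorm ℝ E) (hN : Continuous N) (hpos : ∀ v, v ≠ 0 → 0 < N v)
    (hJ : ∀ v, v ≠ 0 → N (J v) < N v) :
    ∃ ρ : ℝ, 0 ≤ ρ ∧ ρ < 1 ∧ ∃ C : ℝ, ∀ᶠ h in 𝓝 x,
      ∀ n : ℕ, ‖T^[n] h - x‖ ≤ C * ρ ^ n * ‖h - x‖ := by
  have hNs : ∀ (a : ℝ) v, N (a • v) = |a| * N v := fun a v => by
    rw [map_smul_eq_mul, Real.norm_eq_abs]
  have hns : ∀ (a : ℝ) (v : E), ‖a • v‖ = |a| * ‖v‖ := fun a v => by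
    rw [norm_smul, Real.norm_eq_abs]
  obtain ⟨ρ, hρ0, hρ, hρv⟩ := exists_le_mul_of_homogeneous (hN.comp J.continuous) hN
    (fun v => apply_nonneg N _) (fun a v => by simp [hNs]) hNs hpos
  obtain ⟨C₁, hC₁, hN₁, -⟩ := exists_le_mul_of_homogeneous hN continuous_norm
    (fun v => apply_nonneg N _) hNs hns fun v hv => norm_pos_iff.2 hv
  obtain ⟨C₂, hC₂, hN₂, -⟩ := exists_le_mul_of_homogeneous continuous_norm hN
    (fun v => norm_nonneg _) hns hNs hpos
  have hρ1 : ρ < 1 := by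
    rcases hρv with h | ⟨v, hv, h⟩
    · rw [h]
      exact one_pos
    · have h1 := hJ v hv
      simp only [Function.comp_apply] at h
      rw [h] at h1
      by_contra! hc
      nlinarith [hpos v hv]
  -- After both changes of norm the remainder costs at most `(1 - ρ) / 2`, which leaves the rate `(1
  -- + ρ) / 2`.
  set ε := (1 - ρ) / 2 / (C₁ * C₂ + 1) with hε
  have hCC : 0 < C₁ * C₂ + 1 := by positivity
  have hε0 : 0 < ε := div_pos (by linarith) hCC
  have hεC : C₁ * (ε * C₂) ≤ (1 - ρ) / 2 := by
    have : ε * (C₁ * C₂ + 1) = (1 - ρ) / 2 := div_mul_cancel₀ _ hCC.ne'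
    nlinarith
  have hstep : ∀ᶠ h in 𝓝 x, N (T h - x) ≤ (1 + ρ) / 2 * N (h - x) := by
    filter_upwards [hT.isLittleO.def hε0] with h hh
    rw [hx] at hh
    have e : T h - x = J (h - x) + (T h - x - J (h - x)) := by abel
    have h1 := hρ (h - x)
    simp only [Function.comp_apply] at h1
    have h2 : N (T h - x - J (h - x)) ≤ C₁ * (ε * C₂) * N (h - x) := by
      calc _ ≤ C₁ * ‖T h - x - J (h - x)‖ := hN₁ _
        _ ≤ C₁ * (ε * (C₂ * N (h - x))) := by
          gcongr
          exact hh.trans (mul_le_mul_of_nonneg_left (hN₂ _) hε0.le)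
        _ = _ := by ring
    have h3 := mul_le_mul_of_nonneg_right hεC (apply_nonneg N (h - x))
    calc N (T h - x) = N (J (h - x) + (T h - x - J (h - x))) := by rw [← e]
      _ ≤ _ := map_add_le_add N _ _
      _ ≤ _ := by linarith
  obtain ⟨δ, hδ, hball⟩ := Metric.eventually_nhds_iff.1 hstep
  have hC₂' : 0 < C₂ + 1 := by positivity
  refine ⟨(1 + ρ) / 2, by linarith, by linarith, C₂ * C₁, ?_⟩
  -- Smallness is measured in `N`, which does not grow along the orbit, so all iterates stay in the
  -- `δ`-ball; the `+ 1` covers `C₂ = 0`.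
  have hnear : ∀ᶠ h in 𝓝 x, N (h - x) < δ / (C₂ + 1) := by
    have hc : Continuous fun h => N (h - x) := hN.comp (continuous_id.sub continuous_const)
    refine hc.continuousAt.eventually_lt continuousAt_const ?_
    simpa using div_pos hδ hC₂'
  filter_upwards [hnear] with h hh n
  have hr1 : (1 + ρ) / 2 ≤ 1 := by linarith
  have hr0 : 0 ≤ (1 + ρ) / 2 := by linarith
  have hiter : N (T^[n] h - x) ≤ ((1 + ρ) / 2) ^ n * N (h - x) := by
    induction n with
    | zero => simp
    | succ n ih =>
      rw [Function.iterate_succ_apply', pow_succ', mul_assoc]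
      refine le_trans (hball ?_) (mul_le_mul_of_nonneg_left ih hr0)
      rw [dist_eq_norm]
      have h1 : N (T^[n] h - x) < δ / (C₂ + 1) :=
        (ih.trans (mul_le_of_le_one_left (apply_nonneg N _) (pow_le_one₀ hr0 hr1))).trans_lt hh
      rw [lt_div_iff₀ hC₂'] at h1
      have h2 := hN₂ (T^[n] h - x)
      have h3 := apply_nonneg N (T^[n] h - x)
      nlinarith
  calc ‖T^[n] h - x‖ ≤ C₂ * N (T^[n] h - x) := hN₂ _
    _ ≤ C₂ * (((1 + ρ) / 2) ^ n * (C₁ * ‖h - x‖)) := by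
      gcongr
      exact hiter.trans (mul_le_mul_of_nonneg_left (hN₁ _) (by positivity))
    _ = _ := by ring

/-- The bound holds on one neighbourhood for all `n`, so the derivative `J ^ n` of the iterate has
norm at most `|C| * ρ ^ n`; yet it fixes `v`. -/
theorem not_geometric_rate_of_fixed_vector {E : Type*} [NormedAddCommGroup E] [NormedSpace ℝ E]
    {T : E → E} {J : E →L[ℝ] E} {x : E} (hT : HasFDerivAt T J x) (hx : T x = x) {v : E}
    (hv : v ≠ 0) (hJv : J v = v) {ρ C : ℝ} (hρ0 : 0 ≤ ρ) (hρ1 : ρ < 1) :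
    ¬ ∀ᶠ h in 𝓝 x, ∀ n : ℕ, ‖T^[n] h - x‖ ≤ C * ρ ^ n * ‖h - x‖ := by
  intro hc
  have hpow : ∀ n : ℕ, (J ^ n) v = v := by
    intro n
    induction n with
    | zero => simp
    | succ n ih =>
      rw [pow_succ]
      exact (congrArg (J ^ n) hJv).trans ih
  have hle : ∀ n : ℕ, ‖v‖ ≤ |C| * ρ ^ n * ‖v‖ := by
    intro n
    have h1 : HasFDerivAt T^[n] (J ^ n) x := hT.iterate hx n
    have h2 : ‖J ^ n‖ ≤ |C| * ρ ^ n := by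
      refine h1.le_of_lip' (by positivity) ?_
      filter_upwards [hc] with h hh
      rw [Function.iterate_fixed hx]
      refine (hh n).trans ?_
      gcongr
      exact le_abs_self C
    calc ‖v‖ = ‖(J ^ n) v‖ := by rw [hpow]
      _ ≤ ‖J ^ n‖ * ‖v‖ := (J ^ n).le_opNorm v
      _ ≤ _ := by gcongr
  have hlim : Tendsto (fun n : ℕ => |C| * ρ ^ n * ‖v‖) atTop (𝓝 (|C| * 0 * ‖v‖)) :=
    ((tendsto_pow_atTop_nhds_zero_of_lt_one hρ0 hρ1).const_mul _).mul_const _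
  have := ge_of_tendsto' hlim hle
  rw [mul_zero, zero_mul] at this
  exact hv (norm_le_zero_iff.1 this)

open scoped MatrixOrder Matrix.Norms.L2Operator in
-- Factor `A = yᵀ y` and take the Euclidean norm of `y v`.
theorem exists_seminorm_of_posDef {n : Type*} [Fintype n] [DecidableEq n] {A : Matrix n n ℝ}
    (hA : A.PosDef) :
    ∃ N : Seminorm ℝ (n → ℝ), Continuous N ∧ ∀ v, N v ^ 2 = v ⬝ᵥ A *ᵥ v := by
  obtain ⟨y, hy⟩ := CStarAlgebra.nonneg_iff_eq_star_mul_self.mp hA.posSemidef.nonneg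
  rw [Matrix.star_eq_conjTranspose, Matrix.conjTranspose_eq_transpose_of_trivial] at hy
  let L : (n → ℝ) →ₗ[ℝ] EuclideanSpace ℝ n :=
    (WithLp.linearEquiv 2 ℝ (n → ℝ)).symm.toLinearMap.comp y.mulVecLin
  refine ⟨(normSeminorm ℝ (EuclideanSpace ℝ n)).comp L, ?_, fun v => ?_⟩
  · exact continuous_norm.comp L.continuous_of_finiteDimensional
  · change ‖(WithLp.toLp 2 (y *ᵥ v) : EuclideanSpace ℝ n)‖ ^ 2 = _
    rw [EuclideanSpace.real_norm_sq_eq, hy, ← Matrix.mulVec_mulVec, Matrix.dotProduct_mulVec,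
      Matrix.vecMul_transpose]
    simp [dotProduct, sq]

/-! ### Divergence and the Pythagorean identity -/

/-- The Kullback-Leibler divergence of two distributions on the table. -/
noncomputable def klDiv (p q : Cell r → ℝ) : ℝ := ∑ x, p x * (Real.log (p x) - Real.log (q x))

theorem sub_le_mul_log_sub_log {a b : ℝ} (ha : 0 < a) (hb : 0 < b) :
    a - b ≤ a * (Real.log a - Real.log b) := by
  have h := Real.log_le_sub_one_of_pos (div_pos hb ha)
  rw [Real.log_div hb.ne' ha.ne'] at h
  have h2 := mul_le_mul_of_nonneg_left h ha.le
  rw [mul_sub, mul_sub, mul_div_cancel₀ _ ha.ne'] at h2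
  linarith

theorem klDiv_nonneg {p q : Cell r → ℝ} (hp : p ∈ Distr r) (hq : q ∈ Distr r) :
    0 ≤ klDiv p q := by
  have h : ∑ x, (p x - q x) ≤ klDiv p q :=
    Finset.sum_le_sum fun x _ => sub_le_mul_log_sub_log (hp.1 x) (hq.1 x)
  rwa [Finset.sum_sub_distrib, hp.2, hq.2, sub_self] at h

theorem eq_of_klDiv_eq_zero {p q : Cell r → ℝ} (hp : p ∈ Distr r) (hq : q ∈ Distr r)
    (h : klDiv p q = 0) : p = q := by
  have h0 : ∑ x, (p x * (Real.log (p x) - Real.log (q x)) - (p x - q x)) = 0 := by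
    rw [Finset.sum_sub_distrib, Finset.sum_sub_distrib, hp.2, hq.2]
    change klDiv p q - _ = 0
    rw [h]
    ring
  rw [Finset.sum_eq_zero_iff_of_nonneg fun x _ =>
    sub_nonneg.2 (sub_le_mul_log_sub_log (hp.1 x) (hq.1 x))] at h0
  ext x
  have hx := h0 x (Finset.mem_univ x)
  by_contra hne
  have hpx := hp.1 x
  have hqx := hq.1 x
  have h1 := Real.log_lt_sub_one_of_pos (div_pos hqx hpx) fun h1 => hne (by
    rw [div_eq_one_iff_eq hpx.ne'] at h1
    exact h1.symm)
  rw [Real.log_div hqx.ne' hpx.ne'] at h1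
  have h2 := mul_lt_mul_of_pos_left h1 hpx
  rw [mul_sub, mul_sub, mul_div_cancel₀ _ hpx.ne'] at h2
  linarith

/-- The generalized Pythagorean identity. -/
theorem klDiv_eq_add {p q s : Cell r → ℝ} (hp : p ∈ Distr r) (hq : q ∈ Distr r)
    (horth : ∀ t, mu p t = mu q t ∨ eta q t = eta s t) :
    klDiv p s = klDiv p q + klDiv q s := by
  obtain ⟨c, hc⟩ := exists_log_eq (π := q)
  obtain ⟨c', hc'⟩ := exists_log_eq (π := s)
  -- Constants drop out by equal masses. What remains pairs `mu p - mu q` with `eta q - eta s`, and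
  -- each parameter contributes a zero factor.
  have h1 : ∑ x, (p x - q x) * (Real.log (q x) - Real.log (s x)) = 0 := by
    have h2 : ∀ x, (p x - q x) * (Real.log (q x) - Real.log (s x)) =
        (c - c') * (p x - q x) + (p - q) x * (G r *ᵥ (eta q - eta s)) x := fun x => by
      rw [hc, hc', Matrix.mulVec_sub, Pi.sub_apply, Pi.sub_apply]
      ring
    simp only [h2]
    rw [Finset.sum_add_distrib, ← Finset.mul_sum, Finset.sum_sub_distrib, hp.2, hq.2, sub_self,
      mul_zero, zero_add]
    change (p - q) ⬝ᵥ G r *ᵥ (eta q - eta s) = 0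
    rw [Matrix.dotProduct_mulVec, ← Matrix.mulVec_transpose, Matrix.mulVec_sub, ← mu_eq, ← mu_eq]
    refine Finset.sum_eq_zero fun t _ => ?_
    rcases horth t with h | h
    · rw [Pi.sub_apply, h, sub_self, zero_mul]
    · rw [Pi.sub_apply (eta q), h, sub_self, mul_zero]
  rw [← sub_eq_zero, ← h1, klDiv, klDiv, klDiv, ← Finset.sum_add_distrib,
    ← Finset.sum_sub_distrib]
  exact Finset.sum_congr rfl fun x _ => by ring

/-! ### Smooth dependence and implicit differentiation -/

/-- When `A` and `B` cover all parameters, `etaMu` has a smooth inverse on its image, so the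
prescribed components control `g`. -/
theorem contDiff_of_etaMu {A B : Finset (Param r)} (hAB : ∀ t, t ∈ A ∨ t ∈ B)
    (hcard : A.card + B.card = Fintype.card (Param r)) {X : Type*} [NormedAddCommGroup X]
    [NormedSpace ℝ X] {g : X → Param r → ℝ} (hA : ∀ t ∈ A, ContDiff ℝ ∞ fun x => g x t)
    (hB : ∀ t ∈ B, ContDiff ℝ ∞ fun x => mu (expFam (g x)) t) : ContDiff ℝ ∞ g := by
  have hnd : ∀ p ∈ Distr r, Nondegenerate A B p := fun p hp => nondegenerate_of_cover hAB hp
  have hinj := (injective_etaMu hnd).injOn (s := Set.univ)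
  have h := (etaMu_isOpen_image_and_contDiffOn hcard isOpen_univ hinj
    fun θ _ => hnd _ (expFam_mem θ)).2
  have hc₁ : ContDiff ℝ ∞ fun x => (etaMu A B (g x)).1 := contDiff_pi.2 fun t => hA t.1 t.2
  have hc₂ : ContDiff ℝ ∞ fun x => (etaMu A B (g x)).2 := contDiff_pi.2 fun t => hB t.1 t.2
  have hc : ContDiff ℝ ∞ fun x => etaMu A B (g x) := hc₁.prodMk hc₂
  have h2 : ContDiff ℝ ∞ fun x => Function.invFunOn (etaMu A B) Set.univ (etaMu A B (g x)) :=
    h.comp_contDiff hc fun x => ⟨g x, trivial, rfl⟩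
  have h3 : (fun x => Function.invFunOn (etaMu A B) Set.univ (etaMu A B (g x))) = g :=
    funext fun x => hinj.leftInvOn_invFunOn trivial
  rwa [h3] at h2

section Derivative

variable {X : Type*} [NormedAddCommGroup X] [NormedSpace ℝ X] {g : X → Param r → ℝ}
  {D : X →L[ℝ] Param r → ℝ} {x : X} {c : X → ℝ} {c' : X →L[ℝ] ℝ} {t : Param r}

theorem fderiv_apply_eq (hg : HasFDerivAt g D x) (h : ∀ y, g y t = c y)
    (hc : HasFDerivAt c c' x) (v : X) : D v t = c' v := by
  have h1 := hasFDerivAt_pi'.1 hg t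
  rw [funext h] at h1
  rw [← h1.unique hc]
  rfl

theorem F_mulVec_fderiv_eq (hg : HasFDerivAt g D x) (h : ∀ y, mu (expFam (g y)) t = c y)
    (hc : HasFDerivAt c c' x) (v : X) : (F (expFam (g x)) *ᵥ D v) t = c' v := by
  have h1 := hasFDerivAt_pi'.1 ((hasFDerivAt_mu_expFam (g x)).comp x hg) t
  have h2 : (fun y => ((fun θ => mu (expFam θ)) ∘ g) y t) = c := funext h
  rw [h2] at h1
  rw [← h1.unique hc]
  rfl

end Derivative

/-! ### The M-step, the L-step and their Jacobian -/

section Algorithm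

variable {V I H : Finset (Param r)} {ξ : Xi V I H}

theorem IsMStep.unique {h : H → ℝ} {p p' : Cell r → ℝ} (hp : IsMStep V I H ξ h p)
    (hp' : IsMStep V I H ξ h p') : p = p' := by
  refine eq_of_nondegenerate (A := Vᶜ) (B := V)
    (fun π hπ => nondegenerate_of_cover (fun t => ?_) hπ) hp.1 hp'.1 (fun t ht => ?_)
    fun t ht => (hp.2.1 ⟨t, ht⟩).trans (hp'.2.1 ⟨t, ht⟩).symm
  · rw [Finset.mem_compl]
    tauto
  · rw [Finset.mem_compl] at ht
    by_cases htH : t ∈ H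
    · exact congrFun (hp.2.2.2.trans hp'.2.2.2.symm) ⟨t, htH⟩
    · have htf : t ∈ freeEta V I H := mem_freeEta_iff.2 ⟨fun h => ht (Finset.mem_sdiff.1 h).1, htH⟩
      exact (hp.2.2.1 ⟨t, htf⟩ ht).trans (hp'.2.2.1 ⟨t, htf⟩ ht).symm

theorem IsLStep.unique {m : H → ℝ} {q q' : Cell r → ℝ} (hq : IsLStep V I H ξ m q)
    (hq' : IsLStep V I H ξ m q') : q = q' := by
  refine eq_of_nondegenerate (A := freeEta V I H) (B := V \ I ∪ H)
    (fun π hπ => nondegenerate_of_cover (fun t => ?_) hπ) hq.1 hq'.1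
    (fun t ht => (hq.2.2.2 ⟨t, ht⟩).trans (hq'.2.2.2 ⟨t, ht⟩).symm) fun t ht => ?_
  · rw [mem_freeEta_iff, Finset.mem_union]
    tauto
  · by_cases htH : t ∈ H
    · exact congrFun (hq.2.2.1.trans hq'.2.2.1.symm) ⟨t, htH⟩
    · have h1 := Finset.mem_sdiff.1 ((Finset.mem_union.1 ht).resolve_right htH)
      exact (hq.2.1 ⟨t, h1.1⟩ h1.2).trans (hq'.2.1 ⟨t, h1.1⟩ h1.2).symm

theorem exists_isMStep (hH : Disjoint H V) (hξ : ξ ∈ xi V I H '' Distr r) (h : H → ℝ) :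
    ∃ p, IsMStep V I H ξ h p := by
  obtain ⟨π, hπ, rfl⟩ := hξ
  obtain ⟨θ, h1, h2⟩ := exists_mixed V hπ fun t => if ht : t ∈ H then h ⟨t, ht⟩ else eta π t
  refine ⟨expFam θ, expFam_mem θ, fun t => h2 t.1 t.2, fun t ht => ?_, ?_⟩
  · rw [eta_expFam, h1 t.1 ht, dif_neg (mem_freeEta_iff.1 t.2).2]
    rfl
  · ext t
    rw [etaOn, eta_expFam, h1 t.1 (Finset.disjoint_left.1 hH t.2), dif_pos t.2]

theorem exists_isLStep {h : H → ℝ} {p : Cell r → ℝ}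
    (hp : IsMStep V I H ξ h p) : ∃ q, IsLStep V I H ξ (muOn H p) q := by
  -- The default `0` plays no role: outside `R ∪ H` every index belongs to `freeEta`.
  obtain ⟨θ, h1, h2⟩ := exists_mixed (V \ I ∪ H) hp.1 fun t =>
    if ht : t ∈ freeEta V I H then ξ.1 ⟨t, ht⟩ else 0
  refine ⟨expFam θ, expFam_mem θ, fun t ht => ?_, ?_, fun t => ?_⟩
  · rw [h2 t.1 (Finset.mem_union_left _ (Finset.mem_sdiff.2 ⟨t.2, ht⟩)), hp.2.1 t]
  · ext t
    exact h2 t.1 (Finset.mem_union_right _ t.2)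
  · have ht := mem_freeEta_iff.1 t.2
    rw [eta_expFam, h1 t.1 (by rw [Finset.mem_union]; tauto), dif_pos t.2]

theorem mDist_spec (hH : Disjoint H V) (hξ : ξ ∈ xi V I H '' Distr r) (h : H → ℝ) :
    IsMStep V I H ξ h (mDist V I H ξ h) :=
  Classical.epsilon_spec (exists_isMStep hH hξ h)

theorem lDist_spec (hH : Disjoint H V) (hξ : ξ ∈ xi V I H '' Distr r) (h : H → ℝ) :
    IsLStep V I H ξ (muOn H (mDist V I H ξ h)) (lDist V I H ξ h) :=
  Classical.epsilon_spec (exists_isLStep (mDist_spec hH hξ h))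

theorem isMStep_self {π : Cell r → ℝ} (hπ : π ∈ Distr r) (hξ : xi V I H π = ξ) :
    IsMStep V I H ξ (etaOn H π) π := by
  subst hξ
  exact ⟨hπ, fun _ => rfl, fun _ _ => rfl, rfl⟩

theorem isLStep_self {π : Cell r → ℝ} (hπ : π ∈ Distr r) (hξ : xi V I H π = ξ) :
    IsLStep V I H ξ (muOn H π) π := by
  subst hξ
  exact ⟨hπ, fun _ _ => rfl, rfl, fun _ => rfl⟩

theorem mDist_self (hH : Disjoint H V) {π : Cell r → ℝ} (hπ : π ∈ Distr r)
    (hξ : xi V I H π = ξ) : mDist V I H ξ (etaOn H π) = π :=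
  (mDist_spec hH ⟨π, hπ, hξ⟩ _).unique (isMStep_self hπ hξ)

theorem lDist_self (hH : Disjoint H V) {π : Cell r → ℝ} (hπ : π ∈ Distr r)
    (hξ : xi V I H π = ξ) : lDist V I H ξ (etaOn H π) = π := by
  have h := lDist_spec hH ⟨π, hπ, hξ⟩ (etaOn H π)
  rw [mDist_self hH hπ hξ] at h
  exact h.unique (isLStep_self hπ hξ)

theorem lmStep_self (hH : Disjoint H V) {π : Cell r → ℝ} (hπ : π ∈ Distr r)
    (hξ : xi V I H π = ξ) : lmStep V I H ξ (etaOn H π) = etaOn H π := by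
  rw [lmStep, lDist_self hH hπ hξ]

theorem contDiff_eta_mDist (hH : Disjoint H V) (hξ : ξ ∈ xi V I H '' Distr r) :
    ContDiff ℝ ∞ fun h => eta (mDist V I H ξ h) := by
  have hm := mDist_spec hH hξ
  refine contDiff_of_etaMu (A := Vᶜ) (B := V) (fun t => ?_) (Finset.card_compl_add_card V)
    (fun t ht => ?_) fun t ht => ?_
  · rw [Finset.mem_compl]
    tauto
  · rw [Finset.mem_compl] at ht
    by_cases htH : t ∈ H
    · have h1 : (fun h => eta (mDist V I H ξ h) t) = fun h : H → ℝ => h ⟨t, htH⟩ :=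
        funext fun h => congrFun (hm h).2.2.2 ⟨t, htH⟩
      rw [h1]
      exact contDiff_apply ℝ ℝ _
    · have htf : t ∈ freeEta V I H := mem_freeEta_iff.2 ⟨fun h => ht (Finset.mem_sdiff.1 h).1, htH⟩
      have h1 : (fun h => eta (mDist V I H ξ h) t) = fun _ => ξ.1 ⟨t, htf⟩ :=
        funext fun h => (hm h).2.2.1 ⟨t, htf⟩ ht
      rw [h1]
      exact contDiff_const
  · have h1 : (fun h => mu (expFam (eta (mDist V I H ξ h))) t) = fun _ => ξ.2 ⟨t, ht⟩ :=
      funext fun h => by rw [expFam_eta (hm h).1, ← (hm h).2.1 ⟨t, ht⟩]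
    rw [h1]
    exact contDiff_const

theorem contDiff_mDist (hH : Disjoint H V) (hξ : ξ ∈ xi V I H '' Distr r) :
    ContDiff ℝ ∞ (mDist V I H ξ) := by
  have h : mDist V I H ξ = fun h => expFam (eta (mDist V I H ξ h)) :=
    funext fun h => (expFam_eta (mDist_spec hH hξ h).1).symm
  rw [h]
  exact contDiff_expFam.comp (contDiff_eta_mDist hH hξ)

theorem card_freeEta_add_card_sdiff_union :
    (freeEta V I H).card + (V \ I ∪ H).card = Fintype.card (Param r) := by
  have h1 : freeEta V I H = (V \ I ∪ H)ᶜ := by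
    ext t
    rw [mem_freeEta_iff]
    simp
  rw [h1, Finset.card_compl_add_card]

theorem contDiff_eta_lDist (hH : Disjoint H V) (hξ : ξ ∈ xi V I H '' Distr r) :
    ContDiff ℝ ∞ fun h => eta (lDist V I H ξ h) := by
  have hl := lDist_spec hH hξ
  refine contDiff_of_etaMu (A := freeEta V I H) (B := V \ I ∪ H) (fun t => ?_)
    card_freeEta_add_card_sdiff_union (fun t ht => ?_) fun t ht => ?_
  · rw [mem_freeEta_iff, Finset.mem_union]
    tauto
  · have h1 : (fun h => eta (lDist V I H ξ h) t) = fun _ => ξ.1 ⟨t, ht⟩ :=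
      funext fun h => (hl h).2.2.2 ⟨t, ht⟩
    rw [h1]
    exact contDiff_const
  · by_cases htH : t ∈ H
    · have h1 : (fun h => mu (expFam (eta (lDist V I H ξ h))) t) =
          fun h => mu (expFam (eta (mDist V I H ξ h))) t := funext fun h => by
        rw [expFam_eta (hl h).1, expFam_eta (mDist_spec hH hξ h).1]
        exact congrFun (hl h).2.2.1 ⟨t, htH⟩
      rw [h1]
      exact contDiff_pi.1 (contDiff_mu_expFam.comp (contDiff_eta_mDist hH hξ)) t
    · have h2 := Finset.mem_sdiff.1 ((Finset.mem_union.1 ht).resolve_right htH)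
      have h1 : (fun h => mu (expFam (eta (lDist V I H ξ h))) t) = fun _ => ξ.2 ⟨t, h2.1⟩ :=
        funext fun h => by rw [expFam_eta (hl h).1, ← (hl h).2.1 ⟨t, h2.1⟩ h2.2]
      rw [h1]
      exact contDiff_const

theorem contDiff_lDist (hH : Disjoint H V) (hξ : ξ ∈ xi V I H '' Distr r) :
    ContDiff ℝ ∞ (lDist V I H ξ) := by
  have h : lDist V I H ξ = fun h => expFam (eta (lDist V I H ξ h)) :=
    funext fun h => (expFam_eta (lDist_spec hH hξ h).1).symm
  rw [h]
  exact contDiff_expFam.comp (contDiff_eta_lDist hH hξ)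

theorem contDiff_lmStep (hH : Disjoint H V) (hξ : ξ ∈ xi V I H '' Distr r) :
    ContDiff ℝ ∞ (lmStep V I H ξ) :=
  contDiff_pi.2 fun t => contDiff_pi.1 (contDiff_eta_lDist hH hξ) t.1

/-- Differentiating the constraints makes `D v` and `D' v` Schur extensions with respect to `V` and
`R`. Equality of the mean parameters in `H` then reads `A (D' v)_H = B v`. -/
theorem hasFDerivAt_lmStep (hH : Disjoint H V) {π : Cell r → ℝ} (hπ : π ∈ Distr r)
    (hξ : xi V I H π = ξ) :
    HasFDerivAt (lmStep V I H ξ)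
      (LinearMap.toContinuousLinearMap (Jac V I H π).mulVecLin) (etaOn H π) := by
  have hξ' : ξ ∈ xi V I H '' Distr r := ⟨π, hπ, hξ⟩
  have hm := mDist_spec hH hξ'
  have hl := lDist_spec hH hξ'
  set x := etaOn H π with hx
  have hmx : expFam (eta (mDist V I H ξ x)) = π := by rw [mDist_self hH hπ hξ, expFam_eta hπ]
  have hlx : expFam (eta (lDist V I H ξ x)) = π := by rw [lDist_self hH hπ hξ, expFam_eta hπ]
  obtain ⟨D, hD⟩ := (contDiff_eta_mDist hH hξ').differentiable (by simp) x
  obtain ⟨D', hD'⟩ := (contDiff_eta_lDist hH hξ').differentiable (by simp) x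
  have key : ∀ v, (fun t : H => D' v t.1) = Jac V I H π *ᵥ v := by
    intro v
    have m1 : ∀ t, t ∉ V → t ∉ H → D v t = 0 := fun t ht htH => by
      have htf : t ∈ freeEta V I H :=
        mem_freeEta_iff.2 ⟨fun h => ht (Finset.mem_sdiff.1 h).1, htH⟩
      exact fderiv_apply_eq hD (fun h => (hm h).2.2.1 ⟨t, htf⟩ ht) (hasFDerivAt_const _ _) v
    have m2 : (fun t : H => D v t.1) = v := funext fun t =>
      fderiv_apply_eq hD (fun h => congrFun (hm h).2.2.2 t) (hasFDerivAt_apply t x) v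
    have m3 : ∀ t ∈ V, (F π *ᵥ D v) t = 0 := fun t ht => by
      have h := F_mulVec_fderiv_eq hD (t := t) (c := fun _ => ξ.2 ⟨t, ht⟩)
        (fun h => by rw [expFam_eta (hm h).1, ← (hm h).2.1 ⟨t, ht⟩]) (hasFDerivAt_const _ _) v
      rw [hmx] at h
      exact h
    have l1 : ∀ t, t ∉ V \ I → t ∉ H → D' v t = 0 := fun t ht htH =>
      fderiv_apply_eq hD' (fun h => (hl h).2.2.2 ⟨t, mem_freeEta_iff.2 ⟨ht, htH⟩⟩)
        (hasFDerivAt_const _ _) v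
    have l2 : ∀ t ∈ V \ I, (F π *ᵥ D' v) t = 0 := fun t ht => by
      have ht' := Finset.mem_sdiff.1 ht
      have h := F_mulVec_fderiv_eq hD' (t := t) (c := fun _ => ξ.2 ⟨t, ht'.1⟩)
        (fun h => by rw [expFam_eta (hl h).1, ← (hl h).2.1 ⟨t, ht'.1⟩ ht'.2])
        (hasFDerivAt_const _ _) v
      rw [hlx] at h
      exact h
    have l3 : ∀ t ∈ H, (F π *ᵥ D' v) t = (F π *ᵥ D v) t := fun t ht => by
      have hc := hasFDerivAt_pi'.1 ((hasFDerivAt_mu_expFam (eta (mDist V I H ξ x))).comp x hD) t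
      have h := F_mulVec_fderiv_eq hD' (t := t)
        (c := fun h => mu (expFam (eta (mDist V I H ξ h))) t)
        (fun h => by
          rw [expFam_eta (hl h).1, expFam_eta (hm h).1]
          exact congrFun (hl h).2.2.1 ⟨t, ht⟩) hc v
      rw [hlx, hmx] at h
      exact h
    have e1 : (fun t : H => (F π *ᵥ D v) t.1) = Fcond π H H V *ᵥ v := funext fun t => by
      rw [F_mulVec_eq_Fcond hH.symm hπ m1 m3 H t, m2]
    have e2 : (fun t : H => (F π *ᵥ D' v) t.1) =
        Fcond π H H (V \ I) *ᵥ fun t => D' v t.1 := funext fun t =>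
      F_mulVec_eq_Fcond (disjoint_sdiff_H hH) hπ l1 l2 H t
    rw [funext fun t : H => l3 t.1 t.2, e1] at e2
    rw [Jac, ← Matrix.mulVec_mulVec, e2, Fcond_inv_mulVec hH hπ]
  refine hasFDerivAt_pi'.2 fun t => ?_
  refine (hasFDerivAt_pi'.1 hD' t.1).congr_fderiv ?_
  ext v
  exact congrFun (key v) t

end Algorithm

/-! ### Convergence, uniqueness of fixed points and the null case -/

section Convergence

variable {V I H : Finset (Param r)} {ξ : Xi V I H}

theorem injOn_xi_iff :
    Set.InjOn (xi V I H) (Distr r) ↔ ∀ p ∈ Distr r, Nondegenerate (freeEta V I H) V p := by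
  constructor
  · intro h p hp
    by_contra hnd
    obtain ⟨π, hπ, π', hπ', hne, hA, hB⟩ := exists_ne_of_not_nondegenerate hp hnd
    exact hne (h hπ hπ' (Prod.ext (funext fun t => hA t.1 t.2) (funext fun t => hB t.1 t.2)))
  · intro h π hπ π' hπ' heq
    exact eq_of_nondegenerate h hπ hπ'
      (fun t ht => congrFun (congrArg Prod.fst heq) ⟨t, ht⟩)
      fun t ht => congrFun (congrArg Prod.snd heq) ⟨t, ht⟩

theorem tendsto_lDist (hH : Disjoint H V) {π : Cell r → ℝ} (hπ : π ∈ Distr r)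
    (hξ : xi V I H π = ξ) {u : ℕ → H → ℝ} (hu : Tendsto u atTop (𝓝 (etaOn H π))) :
    Tendsto (fun n => lDist V I H ξ (u n)) atTop (𝓝 π) := by
  have hξ' : ξ ∈ xi V I H '' Distr r := ⟨π, hπ, hξ⟩
  have h := ((contDiff_lDist hH hξ').continuous.tendsto (etaOn H π)).comp hu
  rwa [lDist_self hH hπ hξ] at h

theorem lmConvergesAt_of_Q_injective (hI : I ⊆ V) (hH : Disjoint H V) {π : Cell r → ℝ}
    (hπ : π ∈ Distr r) (hQ : ∀ v, Q V I H π *ᵥ v = 0 → v = 0) : LMConvergesAt V I H π := by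
  have hA := posDef_Fcond (disjoint_sdiff_H (I := I) hH) hπ
  obtain ⟨N, hN, hNA⟩ := exists_seminorm_of_posDef hA
  obtain ⟨ρ, hρ0, hρ1, C, hC⟩ := exists_geometric_rate (hasFDerivAt_lmStep (I := I) hH hπ rfl)
    (lmStep_self hH hπ rfl) N hN
    (fun v hv => by
      refine (apply_nonneg N v).lt_of_ne' fun h => ?_
      have h1 := hA.dotProduct_mulVec_pos hv
      rw [star_trivial, ← hNA, h] at h1
      simp at h1)
    (fun v hv => by
      refine lt_of_pow_lt_pow_left₀ 2 (apply_nonneg N v) ?_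
      rw [hNA, hNA]
      exact Jac_contracts hI hH hπ fun h => hv (hQ v h))
  refine ⟨ρ, hρ0, hρ1, C, hC.mono fun h hh => ⟨hh, ?_⟩⟩
  have h1 : Tendsto (fun n : ℕ => (lmStep V I H (xi V I H π))^[n] h) atTop (𝓝 (etaOn H π)) := by
    rw [tendsto_iff_norm_sub_tendsto_zero]
    refine squeeze_zero (fun n => norm_nonneg _) hh ?_
    simpa using ((tendsto_pow_atTop_nhds_zero_of_lt_one hρ0 hρ1).const_mul C).mul_const
      ‖h - etaOn H π‖
  exact tendsto_lDist hH hπ rfl h1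

theorem not_lmConvergesAt_of_Q_mulVec (hH : Disjoint H V) {π : Cell r → ℝ} (hπ : π ∈ Distr r)
    {v : H → ℝ} (hv : v ≠ 0) (hQ : Q V I H π *ᵥ v = 0) : ¬ LMConvergesAt V I H π := by
  rintro ⟨ρ, hρ0, hρ1, C, hC⟩
  exact not_geometric_rate_of_fixed_vector (hasFDerivAt_lmStep (I := I) hH hπ rfl)
    (lmStep_self hH hπ rfl) hv (Jac_mulVec_of_Q_mulVec hH hπ hQ) hρ0 hρ1
    (hC.mono fun h hh => hh.1)

/-- Exchanging the roles of `I` and `H` transposes `Q`. -/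
theorem Q_exchange (hH : Disjoint H V) (π : Cell r → ℝ) :
    Q (V \ I ∪ H) H I π = (Q V I H π)ᵀ := by
  have h : (V \ I ∪ H) \ H = V \ I := by
    rw [Finset.union_sdiff_right, sdiff_eq_left]
    exact disjoint_sdiff_H hH
  rw [Q, Q, h, Fcond_transpose]

/-- `Q` is square, so it is injective together with its transpose, which is the matrix belonging to
the exchanged mixed parameters. -/
theorem nondegenerate_exchange (hI : I ⊆ V) (hH : Disjoint H V) (hcard : I.card = H.card)
    {π : Cell r → ℝ} (hπ : π ∈ Distr r) (h : Nondegenerate (freeEta V I H) V π) :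
    Nondegenerate Vᶜ (V \ I ∪ H) π := by
  have h1 : freeEta (V \ I ∪ H) H I = Vᶜ := by
    ext t
    have h2 : t ∈ H → t ∉ V := fun h => Finset.disjoint_left.1 hH h
    have h3 := @hI t
    rw [mem_freeEta_iff]
    simp only [Finset.mem_sdiff, Finset.mem_union, Finset.mem_compl]
    tauto
  rw [nondegenerate_iff hI hH hπ, ← rank_Q_eq_iff hcard] at h
  rw [← h1, nondegenerate_iff Finset.subset_union_right _ hπ, ← rank_Q_eq_iff hcard.symm,
    Q_exchange hH, Matrix.rank_transpose, h, hcard]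
  rw [Finset.disjoint_union_right]
  exact ⟨Finset.disjoint_sdiff, (hH.mono_right hI).symm⟩

theorem mu_lDist_H (hH : Disjoint H V) (hξ : ξ ∈ xi V I H '' Distr r) (h : H → ℝ) {t : Param r}
    (ht : t ∈ H) : mu (mDist V I H ξ h) t = mu (lDist V I H ξ h) t :=
  (congrFun (lDist_spec hH hξ h).2.2.1 ⟨t, ht⟩).symm

theorem mu_mDist_V (hH : Disjoint H V) (hξ : ξ ∈ xi V I H '' Distr r) (h : H → ℝ) {t : Param r}
    (ht : t ∈ V) : mu (mDist V I H ξ h) t = ξ.2 ⟨t, ht⟩ :=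
  (mDist_spec hH hξ h).2.1 ⟨t, ht⟩

theorem mu_lDist_R (hH : Disjoint H V) (hξ : ξ ∈ xi V I H '' Distr r) (h : H → ℝ) {t : Param r}
    (ht : t ∈ V) (hti : t ∉ I) : mu (lDist V I H ξ h) t = ξ.2 ⟨t, ht⟩ :=
  (lDist_spec hH hξ h).2.1 ⟨t, ht⟩ hti

theorem eta_lDist (hH : Disjoint H V) (hξ : ξ ∈ xi V I H '' Distr r) (h : H → ℝ) {t : Param r}
    (ht : t ∈ freeEta V I H) : eta (lDist V I H ξ h) t = ξ.1 ⟨t, ht⟩ :=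
  (lDist_spec hH hξ h).2.2.2 ⟨t, ht⟩

theorem eta_mDist_compl (hH : Disjoint H V) (hξ : ξ ∈ xi V I H '' Distr r) (h : H → ℝ)
    {t : Param r} (ht : t ∉ V) (hf : t ∈ freeEta V I H) :
    eta (mDist V I H ξ h) t = ξ.1 ⟨t, hf⟩ :=
  (mDist_spec hH hξ h).2.2.1 ⟨t, hf⟩ ht

theorem eta_mDist_lmStep (hH : Disjoint H V) (hξ : ξ ∈ xi V I H '' Distr r) (h : H → ℝ)
    {t : Param r} (ht : t ∉ V) :
    eta (mDist V I H ξ (lmStep V I H ξ h)) t = eta (lDist V I H ξ h) t := by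
  by_cases htH : t ∈ H
  · exact congrFun (mDist_spec hH hξ (lmStep V I H ξ h)).2.2.2 ⟨t, htH⟩
  · have hf : t ∈ freeEta V I H := mem_freeEta_iff.2 ⟨fun h => ht (Finset.mem_sdiff.1 h).1, htH⟩
    rw [eta_mDist_compl hH hξ _ ht hf, eta_lDist hH hξ _ hf]

/-- The divergence between the distributions of the two steps does not increase. -/
theorem klDiv_lmStep_add_le (hH : Disjoint H V) (hξ : ξ ∈ xi V I H '' Distr r) (h : H → ℝ) :
    klDiv (mDist V I H ξ (lmStep V I H ξ h)) (lDist V I H ξ (lmStep V I H ξ h)) +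
      klDiv (mDist V I H ξ h) (mDist V I H ξ (lmStep V I H ξ h)) ≤
      klDiv (mDist V I H ξ h) (lDist V I H ξ h) := by
  have hp := fun h => (mDist_spec hH hξ h).1
  have hq := fun h => (lDist_spec hH hξ h).1
  set h' := lmStep V I H ξ h with hh'
  -- The M-distributions at `h` and `h'` share `μ_V`, and the one at `h'` shares `η_L` with the
  -- L-distribution at `h`. In the second identity the shared parameters are `μ_{R ∪ H}` and the
  -- free `eta`.
  have h1 : klDiv (mDist V I H ξ h) (lDist V I H ξ h) =
      klDiv (mDist V I H ξ h) (mDist V I H ξ h') + klDiv (mDist V I H ξ h') (lDist V I H ξ h) := by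
    refine klDiv_eq_add (hp h) (hp h') fun t => ?_
    by_cases ht : t ∈ V
    · left
      rw [mu_mDist_V hH hξ _ ht, mu_mDist_V hH hξ _ ht]
    · exact Or.inr (eta_mDist_lmStep hH hξ h ht)
  have h2 : klDiv (mDist V I H ξ h') (lDist V I H ξ h) =
      klDiv (mDist V I H ξ h') (lDist V I H ξ h') + klDiv (lDist V I H ξ h') (lDist V I H ξ h) := by
    refine klDiv_eq_add (hp h') (hq h') fun t => ?_
    by_cases htH : t ∈ H
    · exact Or.inl (mu_lDist_H hH hξ h' htH)
    by_cases ht : t ∈ V \ I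
    · have ht' := Finset.mem_sdiff.1 ht
      left
      rw [mu_mDist_V hH hξ _ ht'.1, mu_lDist_R hH hξ _ ht'.1 ht'.2]
    · have hf : t ∈ freeEta V I H := mem_freeEta_iff.2 ⟨ht, htH⟩
      right
      rw [eta_lDist hH hξ _ hf, eta_lDist hH hξ _ hf]
  have h3 := klDiv_nonneg (hq h') (hq h)
  linarith

/-- At a fixed guess the two distributions share `η_L` and `μ_{R ∪ H}`, so they coincide by the
exchanged nondegeneracy. The common distribution then has all of `ξ`. -/
theorem eq_of_isFixedPt_lmStep (hI : I ⊆ V) (hH : Disjoint H V) (hcard : I.card = H.card)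
    (hnd : ∀ p ∈ Distr r, Nondegenerate (freeEta V I H) V p) {π : Cell r → ℝ}
    (hπ : π ∈ Distr r) (hξ : xi V I H π = ξ) {h : H → ℝ} (hh : lmStep V I H ξ h = h) :
    h = etaOn H π := by
  have hξ' : ξ ∈ xi V I H '' Distr r := ⟨π, hπ, hξ⟩
  have hp := mDist_spec hH hξ' h
  have hq := lDist_spec hH hξ' h
  have hpq : mDist V I H ξ h = lDist V I H ξ h := by
    refine eq_of_nondegenerate (fun p hp => nondegenerate_exchange hI hH hcard hp (hnd p hp))
      hp.1 hq.1 (fun t ht => ?_) fun t ht => ?_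
    · have h1 := eta_mDist_lmStep hH hξ' h (Finset.mem_compl.1 ht)
      rwa [hh] at h1
    · rcases Finset.mem_union.1 ht with ht | ht
      · have ht' := Finset.mem_sdiff.1 ht
        rw [mu_mDist_V hH hξ' _ ht'.1, mu_lDist_R hH hξ' _ ht'.1 ht'.2]
      · exact mu_lDist_H hH hξ' h ht
  have h1 : xi V I H (mDist V I H ξ h) = ξ := by
    refine Prod.ext (funext fun t => ?_) (funext hp.2.1)
    change eta (mDist V I H ξ h) t.1 = ξ.1 t
    rw [hpq]
    exact hq.2.2.2 t
  have h2 : mDist V I H ξ h = π := injOn_xi_iff.2 hnd hp.1 hπ (h1.trans hξ.symm)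
  rw [← h2]
  exact hp.2.2.2.symm

theorem continuous_klDiv_mDist_lmStep (hH : Disjoint H V) (hξ : ξ ∈ xi V I H '' Distr r) :
    Continuous fun h => klDiv (mDist V I H ξ h) (mDist V I H ξ (lmStep V I H ξ h)) := by
  have hm : ∀ x, Continuous fun h => mDist V I H ξ h x := fun x =>
    (continuous_apply x).comp (contDiff_mDist hH hξ).continuous
  have hlog : ∀ x, Continuous fun h => Real.log (mDist V I H ξ h x) := fun x =>
    (hm x).log fun h => ((mDist_spec hH hξ h).1.1 x).ne'
  exact continuous_finsetSum _ fun x _ => (hm x).mul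
    ((hlog x).sub ((hlog x).comp (contDiff_lmStep hH hξ).continuous))

/-- The divergence decreases and is bounded below, so its drop `φ` tends to zero. Hence every
cluster point is a fixed guess, and there is only one. -/
theorem tendsto_lmStep_iterate_of_isBounded (hI : I ⊆ V) (hH : Disjoint H V)
    (hcard : I.card = H.card) (hnd : ∀ p ∈ Distr r, Nondegenerate (freeEta V I H) V p)
    {π : Cell r → ℝ} (hπ : π ∈ Distr r) (hξ : xi V I H π = ξ) {h : H → ℝ}
    (hb : Bornology.IsBounded (Set.range fun n : ℕ => (lmStep V I H ξ)^[n] h)) :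
    Tendsto (fun n : ℕ => (lmStep V I H ξ)^[n] h) atTop (𝓝 (etaOn H π)) := by
  have hξ' : ξ ∈ xi V I H '' Distr r := ⟨π, hπ, hξ⟩
  set u : ℕ → H → ℝ := fun n => (lmStep V I H ξ)^[n] h with hu
  have hsucc : ∀ n, u (n + 1) = lmStep V I H ξ (u n) := fun n =>
    Function.iterate_succ_apply' _ _ _
  set E : ℕ → ℝ := fun n => klDiv (mDist V I H ξ (u n)) (lDist V I H ξ (u n)) with hE
  set φ : (H → ℝ) → ℝ := fun h => klDiv (mDist V I H ξ h) (mDist V I H ξ (lmStep V I H ξ h))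
  have hφ0 : ∀ h, 0 ≤ φ h := fun h =>
    klDiv_nonneg (mDist_spec hH hξ' _).1 (mDist_spec hH hξ' _).1
  have hstep : ∀ n, E (n + 1) + φ (u n) ≤ E n := fun n => by
    simp only [hE, hsucc]
    exact klDiv_lmStep_add_le hH hξ' (u n)
  have hanti : Antitone E := antitone_nat_of_succ_le fun n => by
    linarith [hstep n, hφ0 (u n)]
  have hbdd : BddBelow (Set.range E) := ⟨0, by
    rintro _ ⟨n, rfl⟩
    exact klDiv_nonneg (mDist_spec hH hξ' _).1 (lDist_spec hH hξ' _).1⟩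
  have hlim := tendsto_atTop_ciInf hanti hbdd
  have hφlim : Tendsto (fun n => φ (u n)) atTop (𝓝 0) := by
    have h1 := hlim.sub (hlim.comp (tendsto_add_atTop_nat 1))
    rw [sub_self] at h1
    exact squeeze_zero (fun n => hφ0 _) (fun n => by
      simp only [Function.comp_apply]
      linarith [hstep n]) h1
  refine hb.isCompact_closure.tendsto_nhds_of_unique_mapClusterPt
    (Eventually.of_forall fun n => subset_closure ⟨n, rfl⟩) fun x _ hx => ?_
  have h1 : MapClusterPt (φ x) atTop (φ ∘ u) :=
    hx.continuousAt_comp (continuous_klDiv_mDist_lmStep hH hξ').continuousAt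
  have h2 : φ x = 0 := eq_of_nhds_neBot (ClusterPt.mono h1 hφlim)
  have h3 := eq_of_klDiv_eq_zero (mDist_spec hH hξ' _).1 (mDist_spec hH hξ' _).1 h2
  refine eq_of_isFixedPt_lmStep hI hH hcard hnd hπ hξ ?_
  rw [← (mDist_spec hH hξ' (lmStep V I H ξ x)).2.2.2, ← h3]
  exact (mDist_spec hH hξ' x).2.2.2

/-- When `Q` vanishes along the fibre of `(η_{(L ∪ I) \ H}, μ_R)`, the mean parameters in `I` are
constant on it, so that `η_H` is unconstrained by `ξ`. -/
theorem exists_xi_eq_of_Q_eq_zero (hH : Disjoint H V)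
    (hξ : ξ ∈ xi V I H '' Distr r)
    (hQ : ∀ m : H → ℝ, ∀ q, IsLStep V I H ξ m q → Q V I H q = 0) (h : H → ℝ) :
    ∃ π ∈ Distr r, xi V I H π = ξ ∧ etaOn H π = h := by
  obtain ⟨π, hπ, hξπ⟩ := hξ
  -- The map `s` will parametrise the fibre of `(η_{(L ∪ I) \ H}, μ_R)` by `η_H = b`.
  have hex : ∀ b : H → ℝ, ∃ θ : Param r → ℝ,
      (∀ t ∉ V \ I, θ t = if ht : t ∈ H then b ⟨t, ht⟩ else eta π t) ∧
      ∀ t ∈ V \ I, mu (expFam θ) t = mu π t := fun b => exists_mixed (V \ I) hπ _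
  choose s hs hsmu using hex
  have hsH : ∀ b (t : H), s b t.1 = b t := fun b t => by
    rw [hs b t.1 (Finset.disjoint_right.1 (disjoint_sdiff_H hH) t.2), dif_pos t.2]
  have hsf : ∀ b, ∀ t ∈ freeEta V I H, s b t = eta π t := fun b t ht => by
    have ht' := mem_freeEta_iff.1 ht
    rw [hs b t ht'.1, dif_neg ht'.2]
  have hL : ∀ b, IsLStep V I H ξ (muOn H (expFam (s b))) (expFam (s b)) := fun b => by
    subst hξπ
    exact ⟨expFam_mem _, fun t ht => hsmu b t.1 (Finset.mem_sdiff.2 ⟨t.2, ht⟩), rfl, fun t => by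
      rw [eta_expFam, hsf b t.1 t.2]
      rfl⟩
  have hdiff : Differentiable ℝ s := by
    refine (contDiff_of_etaMu (A := (V \ I)ᶜ) (B := V \ I) (fun t => ?_)
      (Finset.card_compl_add_card _) (fun t ht => ?_) fun t ht => ?_).differentiable (by simp)
    · rw [Finset.mem_compl]
      tauto
    · rw [Finset.mem_compl] at ht
      by_cases htH : t ∈ H
      · simp only [fun b => hsH b ⟨t, htH⟩]
        exact contDiff_apply ℝ ℝ _
      · simp only [fun b => hsf b t (mem_freeEta_iff.2 ⟨ht, htH⟩)]
        exact contDiff_const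
    · simp only [fun b => hsmu b t ht]
      exact contDiff_const
  -- Along the fibre the derivative of `μ_I` is `Q` applied to the direction in `H`, hence zero.
  have hconst : ∀ t : I, ∀ b b', mu (expFam (s b)) t.1 = mu (expFam (s b')) t.1 := by
    intro t
    have hd : ∀ b, HasFDerivAt (fun b => mu (expFam (s b)) t.1) (0 : (H → ℝ) →L[ℝ] ℝ) b := by
      intro b
      have hD := (hdiff b).hasFDerivAt
      refine (hasFDerivAt_pi'.1 ((hasFDerivAt_mu_expFam (s b)).comp b hD) t.1).congr_fderiv ?_
      ext v
      set Δ := fderiv ℝ s b v with hΔ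
      have h1 : ∀ t, t ∉ V \ I → t ∉ H → Δ t = 0 := fun t ht htH =>
        fderiv_apply_eq hD (fun b => hsf b t (mem_freeEta_iff.2 ⟨ht, htH⟩))
          (hasFDerivAt_const _ _) v
      have h2 : ∀ t ∈ V \ I, (F (expFam (s b)) *ᵥ Δ) t = 0 := fun t ht =>
        F_mulVec_fderiv_eq hD (fun b => hsmu b t ht) (hasFDerivAt_const _ _) v
      have h3 := F_mulVec_eq_Fcond (disjoint_sdiff_H hH) (expFam_mem (s b)) h1 h2 I t
      have h4 : Fcond (expFam (s b)) I H (V \ I) = 0 := hQ _ _ (hL b)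
      rw [h4, Matrix.zero_mulVec] at h3
      exact h3
    exact is_const_of_fderiv_eq_zero (fun b => (hd b).differentiableAt) fun b => (hd b).fderiv
  have hπs : expFam (s (etaOn H π)) = π := by
    refine eq_of_nondegenerate (A := (V \ I)ᶜ) (B := V \ I)
      (fun p hp => nondegenerate_of_cover (fun t => ?_) hp) (expFam_mem _) hπ (fun t ht => ?_)
      (hsmu _)
    · rw [Finset.mem_compl]
      tauto
    · rw [eta_expFam]
      rw [Finset.mem_compl] at ht
      by_cases htH : t ∈ H
      · exact hsH _ ⟨t, htH⟩
      · exact hsf _ t (mem_freeEta_iff.2 ⟨ht, htH⟩)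
  refine ⟨expFam (s h), expFam_mem _, ?_, ?_⟩
  · rw [← hξπ]
    refine Prod.ext (funext fun t => ?_) (funext fun t => ?_)
    · change eta (expFam (s h)) t.1 = eta π t.1
      rw [eta_expFam, hsf h t.1 t.2]
    · change mu (expFam (s h)) t.1 = mu π t.1
      by_cases hti : t.1 ∈ I
      · rw [hconst ⟨t.1, hti⟩ h (etaOn H π), hπs]
      · exact hsmu h t.1 (Finset.mem_sdiff.2 ⟨t.2, hti⟩)
  · ext t
    rw [etaOn, eta_expFam, hsH]

end Convergence

end LMRec

/-! ### The theorem -/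

open LMRec in
theorem theorem1 {ι : Type} [Fintype ι] [DecidableEq ι] (r : ι → ℕ)
    (V I H : Finset (LMRec.Param r)) (hI : I ⊆ V) (hH : Disjoint H V) (hcard : I.card = H.card)
    (hne : I.Nonempty) :
    -- for compatible parameters both steps of the algorithm are well defined, for every guess
    (∀ ξ ∈ LMRec.xi V I H '' LMRec.Distr r, ∀ h : H → ℝ,
      (∃! p, LMRec.IsMStep V I H ξ h p) ∧
      ∀ p, LMRec.IsMStep V I H ξ h p → ∃! q, LMRec.IsLStep V I H ξ (LMRec.muOn H p) q) ∧
    -- `J` is the Jacobian of the LM step at a compatible distribution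
    (∀ π ∈ LMRec.Distr r,
      HasFDerivAt (LMRec.lmStep V I H (LMRec.xi V I H π))
        (LinearMap.toContinuousLinearMap (LMRec.Jac V I H π).mulVecLin) (LMRec.etaOn H π)) ∧
    -- full rank at one distribution
    (∀ π ∈ LMRec.Distr r, (LMRec.Q V I H π).rank = I.card →
      LMRec.LMConvergesAt V I H π ∧
      ∃ U : Set (LMRec.Cell r → ℝ), IsOpen U ∧ π ∈ U ∧
        LMRec.SmoothOneToOneOn V I H (LMRec.Distr r ∩ U)) ∧
    -- full rank at every distribution
    ((∀ π ∈ LMRec.Distr r, (LMRec.Q V I H π).rank = I.card) →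
      LMRec.SmoothOneToOneOn V I H (LMRec.Distr r) ∧
      ∀ π ∈ LMRec.Distr r, ∀ h : H → ℝ,
        Bornology.IsBounded
          (Set.range fun n : ℕ => (LMRec.lmStep V I H (LMRec.xi V I H π))^[n] h) →
        Filter.Tendsto (fun n : ℕ => (LMRec.lmStep V I H (LMRec.xi V I H π))^[n] h)
          Filter.atTop (nhds (LMRec.etaOn H π)) ∧
        Filter.Tendsto (fun n : ℕ => LMRec.lDist V I H (LMRec.xi V I H π)
            ((LMRec.lmStep V I H (LMRec.xi V I H π))^[n] h)) Filter.atTop (nhds π)) ∧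
    -- `Q = 0` at one distribution
    (∀ π ∈ LMRec.Distr r, LMRec.Q V I H π = 0 →
      LMRec.Jac V I H π = 1 ∧ ¬ Set.InjOn (LMRec.xi V I H) (LMRec.Distr r)) ∧
    -- `Q = 0` at all distributions that the L-step can produce for a compatible `ξ`
    (∀ ξ ∈ LMRec.xi V I H '' LMRec.Distr r,
      (∀ m : H → ℝ, ∀ q, LMRec.IsLStep V I H ξ m q → LMRec.Q V I H q = 0) →
      ∀ h : H → ℝ, LMRec.lmStep V I H ξ h = h ∧
        ∃ π ∈ LMRec.Distr r, LMRec.xi V I H π = ξ ∧ LMRec.etaOn H π = h) ∧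
    -- `Q` singular but not null at one distribution
    (∀ π ∈ LMRec.Distr r, LMRec.Q V I H π ≠ 0 → (LMRec.Q V I H π).rank < I.card →
      ¬ LMRec.LMConvergesAt V I H π ∧
      ∃ ξ ∈ LMRec.xi V I H '' LMRec.Distr r, ¬ ∃ π' : LMRec.Cell r → ℝ, ∀ h : H → ℝ,
        Filter.Tendsto (fun n : ℕ => LMRec.lDist V I H ξ ((LMRec.lmStep V I H ξ)^[n] h))
          Filter.atTop (nhds π')) := by
  have hc := card_freeEta_add_card hI hH hcard
  have hnd : ∀ π ∈ Distr r,
      (Nondegenerate (freeEta V I H) V π ↔ (Q V I H π).rank = I.card) := fun π hπ => by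
    rw [nondegenerate_iff hI hH hπ, rank_Q_eq_iff hcard]
  refine ⟨fun ξ hξ h => ⟨?_, fun p hp => ?_⟩, fun π hπ => hasFDerivAt_lmStep hH hπ rfl,
    fun π hπ hrank => ⟨lmConvergesAt_of_Q_injective hI hH hπ ((rank_Q_eq_iff hcard).1 hrank),
      smoothOneToOneOn_near hc hπ ((hnd π hπ).2 hrank)⟩,
    fun hrank => ?_, fun π hπ hQ => ⟨?_, fun hinj => ?_⟩, fun ξ hξ hQ h => ?_,
    fun π hπ _ hrank => ⟨?_, ?_⟩⟩
  · exact ⟨_, mDist_spec hH hξ h, fun p hp => hp.unique (mDist_spec hH hξ h)⟩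
  · obtain ⟨q, hq⟩ := exists_isLStep hp
    exact ⟨q, hq, fun q' hq' => hq'.unique hq⟩
  · have hnd' : ∀ p ∈ Distr r, Nondegenerate (freeEta V I H) V p := fun p hp =>
      (hnd p hp).2 (hrank p hp)
    refine ⟨smoothOneToOneOn_distr hc hnd', fun π hπ h hb => ?_⟩
    have h1 := tendsto_lmStep_iterate_of_isBounded hI hH hcard hnd' hπ rfl hb
    exact ⟨h1, tendsto_lDist hH hπ rfl h1⟩
  · refine Matrix.toLin'.injective (LinearMap.ext fun v => ?_)
    rw [Matrix.toLin'_apply, Matrix.toLin'_apply, Matrix.one_mulVec]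
    exact Jac_mulVec_of_Q_mulVec hH hπ (by rw [hQ, Matrix.zero_mulVec])
  · have h1 := (hnd π hπ).1 (injOn_xi_iff.1 hinj π hπ)
    rw [hQ, Matrix.rank_zero] at h1
    -- Nonemptiness of `I` enters here: for empty `I` the zero matrix would have full rank.
    exact hne.card_pos.ne h1
  · obtain ⟨π, hπ, hξπ, rfl⟩ := exists_xi_eq_of_Q_eq_zero hH hξ hQ h
    exact ⟨lmStep_self hH hπ hξπ, π, hπ, hξπ, rfl⟩
  · have h1 : ¬ ∀ v, Q V I H π *ᵥ v = 0 → v = 0 := fun h =>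
      hrank.ne ((rank_Q_eq_iff hcard).2 h)
    push Not at h1
    obtain ⟨v, hv, hv0⟩ := h1
    exact not_lmConvergesAt_of_Q_mulVec hH hπ hv0 hv
  · have h1 : ¬ Set.InjOn (xi V I H) (Distr r) := fun h =>
      hrank.ne ((hnd π hπ).1 (injOn_xi_iff.1 h π hπ))
    simp only [Set.InjOn, not_forall] at h1
    obtain ⟨π₁, hπ₁, π₂, hπ₂, heq, hne'⟩ := h1
    -- Both `π₁` and `π₂` are stationary for this `ξ`, so a common limit would have to equal each;
    -- neither needs to be the given `π`.
    refine ⟨xi V I H π₁, ⟨π₁, hπ₁, rfl⟩, ?_⟩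
    rintro ⟨π', hπ'⟩
    have key : ∀ p ∈ Distr r, xi V I H p = xi V I H π₁ → p = π' := by
      intro p hp hpe
      refine tendsto_nhds_unique ?_ (hπ' (etaOn H p))
      simp only [Function.iterate_fixed (lmStep_self hH hp hpe), lDist_self hH hp hpe]
      exact tendsto_const_nhds
    exact hne' ((key π₁ hπ₁ rfl).trans (key π₂ hπ₂ heq.symm).symm)
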